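/- Let $\tau\in\mathbb R$ and $0<\varphi<\pi$. Let $\mathcal V\subset L^2(\mathbb R)$ be the subspace of (restrictions to $\mathbb R$ of) functions $f$ that are holomorphic in the closed strip $|\operatorname{Im}s|\le 1$, i.e. in some larger open strip $|\operatorname{Im}s|<1+\delta$ with $\delta>0$, and that satisfy $|f(s)|=O(|\operatorname{Re}s|^{-3/2-\varepsilon})$ as $|\operatorname{Re}s|\to\infty$, uniformly in $|\operatorname{Im}s|\le1$, for some $\varepsilon>0$ ($\delta$ and $\varepsilon$ may depend on $f$). On the domain $\mathcal V$ consider the operator in $L^2(\mathbb R)$ $$ \mathcal Lf(s)=i\left(\tfrac12-is\right)f(s+i)+2(s-\tau)\cos\varphi\, f(s)-i\left(\tfrac12+is-2i\tau\right)f(s-i). $$ Then $\mathcal L$ is densely defined and symmetric, but it is not self-adjoint, and not even essentially self-adjoint (its closure is not self-adjoint). Its defect indices $(\dim\ker(\mathcal L^*-i),\ \dim\ker(\mathcal L^*+i))$ are $(1,1)$. -/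

import Mathlib

open MeasureTheory

/-- The open strip `|Im s| < a`. -/
def openStrip (a : ℝ) : Set ℂ := {s : ℂ | |s.im| < a}

/-- `f` is holomorphic in the closed strip `|Im s| ≤ 1`, i.e. in some larger open strip
`|Im s| < 1 + δ`. -/
def HolomorphicInClosedStrip (f : ℂ → ℂ) : Prop :=
  ∃ δ > 0, DifferentiableOn ℂ f (openStrip (1 + δ))

/-- `f(s) = O(|Re s| ^ (-3/2 - ε))` for some `ε > 0`, uniformly in the closed strip `|Im s| ≤ 1`.
For a function continuous on the closed strip the estimate as `|Re s| → ∞` is the same as the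
global estimate with `1 + |Re s|` used here. -/
def DecaysInClosedStrip (f : ℂ → ℂ) : Prop :=
  ∃ ε > 0, ∃ C : ℝ, ∀ s : ℂ, |s.im| ≤ 1 → ‖f s‖ ≤ C * (1 + |s.re|) ^ (-(3 / 2 : ℝ) - ε)

/-- Functions holomorphic in the strip `|Im s| ≤ 1` and decreasing there as
`O(|Re s| ^ (-3/2 - ε))`. Values far from the strip are irrelevant. -/
def stripSpace : Submodule ℂ (ℂ → ℂ) where
  carrier := {f | HolomorphicInClosedStrip f ∧ DecaysInClosedStrip f}
  zero_mem' :=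
    ⟨⟨1, one_pos, differentiableOn_const 0⟩, ⟨1, one_pos, 0, fun s _ => by simp⟩⟩
  add_mem' := by
    rintro f g ⟨⟨δ, hδ, hf⟩, ε, hε, C, hC⟩ ⟨⟨δ', hδ', hg⟩, ε', hε', C', hC'⟩
    refine ⟨⟨min δ δ', lt_min hδ hδ', ?_⟩, min ε ε', lt_min hε hε', |C| + |C'|, ?_⟩
    · refine (hf.mono ?_).add (hg.mono ?_)
      · intro s (hs : |s.im| < _)
        exact lt_of_lt_of_le hs (by gcongr; exact min_le_left _ _)
      · intro s (hs : |s.im| < _)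
        exact lt_of_lt_of_le hs (by gcongr; exact min_le_right _ _)
    · intro s hs
      have h1 : (1 : ℝ) ≤ 1 + |s.re| := by linarith [abs_nonneg s.re]
      have e1 : (1 + |s.re|) ^ (-(3 / 2 : ℝ) - ε) ≤ (1 + |s.re|) ^ (-(3 / 2 : ℝ) - min ε ε') :=
        Real.rpow_le_rpow_of_exponent_le h1 (by linarith [min_le_left ε ε'])
      have e2 : (1 + |s.re|) ^ (-(3 / 2 : ℝ) - ε') ≤ (1 + |s.re|) ^ (-(3 / 2 : ℝ) - min ε ε') :=
        Real.rpow_le_rpow_of_exponent_le h1 (by linarith [min_le_right ε ε'])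
      calc ‖f s + g s‖ ≤ ‖f s‖ + ‖g s‖ := norm_add_le _ _
        _ ≤ |C| * (1 + |s.re|) ^ (-(3 / 2 : ℝ) - ε) +
            |C'| * (1 + |s.re|) ^ (-(3 / 2 : ℝ) - ε') := by
          refine add_le_add ((hC s hs).trans ?_) ((hC' s hs).trans ?_)
          · gcongr; exact le_abs_self C
          · gcongr; exact le_abs_self C'
        _ ≤ |C| * (1 + |s.re|) ^ (-(3 / 2 : ℝ) - min ε ε') +
            |C'| * (1 + |s.re|) ^ (-(3 / 2 : ℝ) - min ε ε') := by gcongr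
        _ = _ := by ring
  smul_mem' := by
    rintro c f ⟨⟨δ, hδ, hf⟩, ε, hε, C, hC⟩
    refine ⟨⟨δ, hδ, hf.const_smul c⟩, ε, hε, ‖c‖ * C, fun s hs => ?_⟩
    rw [Pi.smul_apply, norm_smul, mul_assoc]
    exact mul_le_mul_of_nonneg_left (hC s hs) (norm_nonneg c)

/-- The difference expression
`i(1/2 - is) f(s+i) + 2(s - τ) cos φ f(s) - i(1/2 + is - 2iτ) f(s-i)`. -/
noncomputable def diffExpr (τ φ : ℝ) (f : ℂ → ℂ) (s : ℂ) : ℂ :=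
  Complex.I * (1 / 2 - Complex.I * s) * f (s + Complex.I)
    + 2 * (s - (τ : ℂ)) * (Real.cos φ : ℂ) * f s
    - Complex.I * (1 / 2 + Complex.I * s - 2 * Complex.I * (τ : ℂ)) * f (s - Complex.I)

/-- The Hilbert space `L²(ℝ)` of complex-valued functions. -/
abbrev L2R : Type := Lp ℂ 2 (volume : Measure ℝ)

theorem stripSpace_continuous_shift {f : ℂ → ℂ} (hf : f ∈ stripSpace) {c : ℂ}
    (him : |c.im| ≤ 1) : Continuous fun x : ℝ => f ((x : ℂ) + c) := by
  obtain ⟨⟨δ, hδ, hd⟩, -⟩ := hf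
  refine hd.continuousOn.comp_continuous (by fun_prop) fun x => ?_
  simp only [openStrip, Set.mem_ofPred_eq, Complex.add_im, Complex.ofReal_im, zero_add]
  linarith

/-- A multiple of a shifted function of the space by a linear factor is square integrable. -/
theorem stripSpace_memLp_shift {f : ℂ → ℂ} (hf : f ∈ stripSpace) {c : ℂ} (hre : c.re = 0)
    (him : |c.im| ≤ 1) (a b : ℂ) :
    MemLp (fun x : ℝ => (a * x + b) * f ((x : ℂ) + c)) 2 volume := by
  have hcont : Continuous fun x : ℝ => (a * x + b) * f ((x : ℂ) + c) :=
    Continuous.mul (by fun_prop) (stripSpace_continuous_shift hf him)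
  obtain ⟨-, ε, hε, C, hC⟩ := hf
  rw [memLp_two_iff_integrable_sq_norm hcont.aestronglyMeasurable]
  have hint : Integrable fun x : ℝ =>
      (((‖a‖ + ‖b‖) * |C|) ^ 2) * (1 + ‖x‖) ^ (-(1 + 2 * ε)) :=
    (integrable_one_add_norm (by simp; linarith)).const_mul _
  refine hint.mono' (hcont.norm.pow 2).aestronglyMeasurable (Filter.Eventually.of_forall fun x => ?_)
  have h0 : (0 : ℝ) < 1 + |x| := by positivity
  have h1 : ‖a * x + b‖ ≤ (‖a‖ + ‖b‖) * (1 + |x|) := by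
    refine (norm_add_le _ _).trans ?_
    rw [norm_mul, Complex.norm_real, Real.norm_eq_abs]
    nlinarith [norm_nonneg a, norm_nonneg b, abs_nonneg x,
      mul_nonneg (norm_nonneg b) (abs_nonneg x)]
  have h2 : ‖f ((x : ℂ) + c)‖ ≤ |C| * (1 + |x|) ^ (-(3 / 2 : ℝ) - ε) := by
    have := hC ((x : ℂ) + c) (by simpa using him)
    simp only [Complex.add_re, Complex.ofReal_re, hre, add_zero] at this
    refine this.trans ?_
    gcongr
    exact le_abs_self C
  have h3 : ‖(a * x + b) * f ((x : ℂ) + c)‖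
      ≤ ((‖a‖ + ‖b‖) * |C|) * ((1 + |x|) * (1 + |x|) ^ (-(3 / 2 : ℝ) - ε)) := by
    rw [norm_mul]
    refine (mul_le_mul h1 h2 (norm_nonneg _) (by positivity)).trans (le_of_eq ?_)
    ring
  have h4 : ((1 + |x|) * (1 + |x|) ^ (-(3 / 2 : ℝ) - ε)) ^ 2 = (1 + |x|) ^ (-(1 + 2 * ε)) := by
    rw [← Real.rpow_one_add' h0.le (by linarith), ← Real.rpow_natCast, ← Real.rpow_mul h0.le]
    congr 1
    push_cast
    ring
  rw [Real.norm_eq_abs, abs_of_nonneg (by positivity), Real.norm_eq_abs, ← h4, ← mul_pow]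
  gcongr

theorem stripSpace_memLp {f : ℂ → ℂ} (hf : f ∈ stripSpace) :
    MemLp (fun x : ℝ => f (x : ℂ)) 2 volume := by
  simpa using stripSpace_memLp_shift hf (c := 0) (by simp) (by simp) 0 1

theorem diffExpr_memLp (τ φ : ℝ) {f : ℂ → ℂ} (hf : f ∈ stripSpace) :
    MemLp (fun x : ℝ => diffExpr τ φ f (x : ℂ)) 2 volume := by
  have h1 := stripSpace_memLp_shift hf (c := Complex.I) (by simp) (by simp)
    1 (Complex.I / 2)
  have h2 := stripSpace_memLp_shift hf (c := 0) (by simp) (by simp)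
    (2 * (Real.cos φ : ℂ)) (-2 * τ * (Real.cos φ : ℂ))
  have h3 := stripSpace_memLp_shift hf (c := -Complex.I) (by simp) (by simp)
    1 (-Complex.I / 2 - 2 * τ)
  refine ((h1.add h2).add h3).ae_eq (Filter.Eventually.of_forall fun x => ?_)
  have hI := Complex.I_mul_I
  simp only [diffExpr, Pi.add_apply, add_zero, sub_eq_add_neg]
  linear_combination ((x : ℂ) * f (x + Complex.I) + (x - 2 * τ) * f (x + -Complex.I)) * hI

/-- Restriction of a function of `stripSpace` to the real line, as an element of `L²(ℝ)`. -/
noncomputable def stripRestrict : stripSpace →ₗ[ℂ] L2R where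
  toFun f := (stripSpace_memLp f.2).toLp _
  map_add' _ _ := rfl
  map_smul' _ _ := rfl

/-- The function `diffExpr τ φ f` on the real line, as an element of `L²(ℝ)`. -/
noncomputable def stripDiff (τ φ : ℝ) : stripSpace →ₗ[ℂ] L2R where
  toFun f := (diffExpr_memLp τ φ f.2).toLp _
  map_add' f g := by
    rw [← MemLp.toLp_add]
    refine MemLp.toLp_congr _ _ (Filter.Eventually.of_forall fun x => ?_)
    simp only [diffExpr, Submodule.coe_add, Pi.add_apply]
    ring
  map_smul' c f := by
    rw [RingHom.id_apply, ← MemLp.toLp_const_smul]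
    refine MemLp.toLp_congr _ _ (Filter.Eventually.of_forall fun x => ?_)
    simp only [diffExpr, Submodule.coe_smul, Pi.smul_apply, smul_eq_mul]
    ring

/-- A function of `stripSpace` is determined on the strip by its class in `L²(ℝ)`. -/
theorem stripSpace_eq_zero {f : stripSpace} (h : stripRestrict f = 0) (s : ℂ) (hs : |s.im| ≤ 1) :
    f.1 s = 0 := by
  have hae : (fun x : ℝ => f.1 (x : ℂ)) =ᵐ[volume] fun _ => (0 : ℂ) := by
    have h1 := (stripSpace_memLp f.2).coeFn_toLp
    have h2 : (stripSpace_memLp f.2).toLp _ = (0 : L2R) := h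
    rw [h2] at h1
    exact h1.symm.trans (Lp.coeFn_zero _ _ _)
  have hc : Continuous fun x : ℝ => f.1 (x : ℂ) := by
    simpa using stripSpace_continuous_shift f.2 (c := 0) (by simp)
  have h0 : ∀ x : ℝ, f.1 (x : ℂ) = 0 :=
    congrFun (Measure.eq_of_ae_eq hae hc continuous_const)
  obtain ⟨⟨δ, hδ, hd⟩, -⟩ := f.2
  have hopen : IsOpen (openStrip (1 + δ)) :=
    isOpen_lt (continuous_abs.comp Complex.continuous_im) continuous_const
  have hconv : Convex ℝ (openStrip (1 + δ)) := by
    have : openStrip (1 + δ) = Complex.imCLM ⁻¹' Metric.ball (0 : ℝ) (1 + δ) := by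
      ext z; simp [openStrip, Metric.mem_ball]
    rw [this]
    exact (convex_ball _ _).is_linear_preimage Complex.imCLM.isLinear
  refine (hd.analyticOnNhd hopen).eqOn_of_preconnected_of_frequently_eq
    (g := fun _ => 0) analyticOnNhd_const hconv.isPreconnected (z₀ := 0)
    (by simp only [openStrip, Set.mem_ofPred_eq, Complex.zero_im, abs_zero]; linarith) ?_
    (by simp only [openStrip, Set.mem_ofPred_eq]; linarith)
  have ht : Filter.Tendsto (fun x : ℝ => (x : ℂ)) (nhdsWithin 0 {0}ᶜ) (nhdsWithin 0 {0}ᶜ) := by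
    refine tendsto_nhdsWithin_iff.2 ⟨?_, ?_⟩
    · have : Filter.Tendsto (fun x : ℝ => (x : ℂ)) (nhds 0) (nhds ((0 : ℝ) : ℂ)) :=
        Complex.continuous_ofReal.tendsto 0
      rw [Complex.ofReal_zero] at this
      exact this.mono_left nhdsWithin_le_nhds
    · filter_upwards [self_mem_nhdsWithin] with x hx
      simpa using hx
  exact ht.frequently (Filter.Frequently.of_forall h0)

theorem stripDiff_eq_zero (τ φ : ℝ) {f : stripSpace} (h : stripRestrict f = 0) :
    stripDiff τ φ f = 0 := by
  have hz := stripSpace_eq_zero h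
  have h1 : (stripDiff τ φ f : ℝ → ℂ) =ᵐ[volume] fun x : ℝ => diffExpr τ φ f.1 (x : ℂ) :=
    (diffExpr_memLp τ φ f.2).coeFn_toLp
  refine (Lp.eq_zero_iff_ae_eq_zero).2 (h1.trans (Filter.Eventually.of_forall fun x => ?_))
  simp only [diffExpr]
  rw [hz _ (by simp), hz _ (by simp), hz _ (by simp)]
  simp

/-- The operator `𝓛` in `L²(ℝ)`. Its domain consists of the classes in `L²(ℝ)` of the functions of
`stripSpace`, and it sends the class of `f` to the class of `diffExpr τ φ f`
(see `diffOp_apply` below; by analytic continuation this does not depend on the choice of `f`). -/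
noncomputable def diffOp (τ φ : ℝ) : L2R →ₗ.[ℂ] L2R where
  domain := LinearMap.range stripRestrict
  toFun :=
    { toFun := fun u => stripDiff τ φ (Classical.choose u.2)
      map_add' := fun u v => by
        rw [← map_add, ← sub_eq_zero, ← map_sub]
        apply stripDiff_eq_zero
        rw [map_sub, map_add, Classical.choose_spec u.2, Classical.choose_spec v.2,
          Classical.choose_spec (u + v).2, Submodule.coe_add, sub_self]
      map_smul' := fun c u => by
        rw [RingHom.id_apply, ← map_smul, ← sub_eq_zero, ← map_sub]
        apply stripDiff_eq_zero
        rw [map_sub, map_smul, Classical.choose_spec u.2, Classical.choose_spec (c • u).2,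
          Submodule.coe_smul, sub_self] }

theorem diffOp_apply (τ φ : ℝ) (f : stripSpace) :
    diffOp τ φ ⟨stripRestrict f, LinearMap.mem_range_self _ f⟩ = stripDiff τ φ f := by
  have key : ∀ u : LinearMap.range stripRestrict, u.1 = stripRestrict f →
      stripDiff τ φ (Classical.choose u.2) = stripDiff τ φ f := fun u hu => by
    rw [← sub_eq_zero, ← map_sub]
    apply stripDiff_eq_zero
    rw [map_sub, Classical.choose_spec u.2, hu, sub_self]
  exact key ⟨stripRestrict f, LinearMap.mem_range_self _ f⟩ rfl

/-- The defect subspace `ker (T† - z)` of a densely defined operator `T`. -/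
noncomputable def defectSpace {H : Type*} [NormedAddCommGroup H] [InnerProductSpace ℂ H]
    [CompleteSpace H] (T : H →ₗ.[ℂ] H) (z : ℂ) : Submodule ℂ T.adjoint.domain :=
  LinearMap.ker (T.adjoint.toFun - z • T.adjoint.domain.subtype)

/-- The defect indices `(n₊, n₋) = (dim ker (T† - i), dim ker (T† + i))` of a densely defined
symmetric operator `T`. -/
noncomputable def defectIndices {H : Type*} [NormedAddCommGroup H] [InnerProductSpace ℂ H]
    [CompleteSpace H] (T : H →ₗ.[ℂ] H) : Cardinal × Cardinal :=
  (Module.rank ℂ (defectSpace T Complex.I), Module.rank ℂ (defectSpace T (-Complex.I)))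

/-! The Fourier transform turns the difference operator into a first order differential operator.
Writing `f(s) = ∫ ψ(ξ) exp(2πisξ) dξ`, the shifts by `±i` become multiplication by `exp(∓2πξ)` and
multiplication by `s` becomes `(i/2π) d/dξ`, so on test functions the operator is `(i/2π)(wψ' +
w'ψ/2) - rψ` with `w = 2 cosh 2πξ + 2 cos φ` and `r` real (`diffExpr_fourierLaplace`). As `|cos φ| <
1`, `w` is positive and `1/w` is integrable over the whole line: the flow of the vector field `w
d/dξ` reaches both ends in finite time. Hence for every complex `z` the solution `m_z = w^(-1/2)
exp(-2πi ∫₀ (z + r)/w)` of the eigenvalue equation lies in `L²` (`memLp_eigenFun`).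

Symmetry is a contour shift (`diffExpr_integral`). Each eigenspace of the adjoint is exactly
one-dimensional. It is at most so because testing with `m_{z̄} η` for a test function `η` shows that
`w m_{z̄} Ū` has zero weak derivative, where `U` is the transform of an eigenvector, so that `U` is
a multiple of `m_z` (`exists_eq_smul_eigenVector`). It is at least so because `m_z`, cut off at ever
larger radii, satisfies the adjoint identity against the whole domain in the limit
(`inner_eigenVector_stripDiff`).

Finally, a self-adjoint operator has no eigenvalue `i`, and the adjoint of the closure extends the
adjoint; a nonzero defect vector therefore excludes self-adjointness of both the operator and its
closure. -/

open scoped ComplexConjugate InnerProductSpace ContDiff FourierTransform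

open Filter Topology

/-! ### Contour shifts and symmetry of the difference expression. -/

/-- Shifting the line of integration from `Im s = 0` to `Im s = 1`. -/
theorem integral_eq_integral_add_I {H : ℂ → ℂ} {C p : ℝ} (hp : 1 < p)
    (hd : DifferentiableOn ℂ H {s | s.im ∈ Set.Icc (0 : ℝ) 1})
    (hb : ∀ s : ℂ, s.im ∈ Set.Icc (0 : ℝ) 1 → ‖H s‖ ≤ C * (1 + |s.re|) ^ (-p)) :
    ∫ x : ℝ, H x = ∫ x : ℝ, H (x + Complex.I) := by
  have hint : ∀ y ∈ Set.Icc (0 : ℝ) 1, Integrable fun x : ℝ => H (x + y * Complex.I) := by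
    intro y hy
    have hc : Continuous fun x : ℝ => H (x + y * Complex.I) :=
      hd.continuousOn.comp_continuous (by fun_prop) fun x => by simpa using hy
    have hi : Integrable fun x : ℝ => C * (1 + ‖x‖) ^ (-p) :=
      (integrable_one_add_norm (by simpa using hp)).const_mul _
    refine hi.mono' hc.aestronglyMeasurable (Eventually.of_forall fun x => ?_)
    simpa using hb (x + y * Complex.I) (by simpa using hy)
  have htop : Tendsto (fun T : ℝ => (1 + T) ^ (-p)) atTop (𝓝 0) :=
    (tendsto_rpow_neg_atTop (by linarith)).comp (tendsto_atTop_add_const_left _ _ tendsto_id)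
  -- Both vertical sides of the rectangle, `σ = 1` and `σ = -1`, are `O(T ^ (-p))`.
  have hvert : ∀ σ : ℝ, |σ| = 1 →
      Tendsto (fun T : ℝ => ∫ y : ℝ in (0 : ℝ)..1, H ((σ * T : ℝ) + y * Complex.I)) atTop (𝓝 0) := by
    intro σ hσ
    have h0 : Tendsto (fun T : ℝ => C * (1 + T) ^ (-p)) atTop (𝓝 0) := by
      simpa using htop.const_mul C
    refine squeeze_zero_norm' ?_ h0
    filter_upwards [eventually_ge_atTop (0 : ℝ)] with T hT
    refine (intervalIntegral.norm_integral_le_of_norm_le_const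
      (C := C * (1 + T) ^ (-p)) fun y hy => ?_).trans (by simp)
    rw [Set.uIoc_of_le zero_le_one] at hy
    have := hb ((σ * T : ℝ) + y * Complex.I) (by simpa using ⟨hy.1.le, hy.2⟩)
    simpa [abs_mul, hσ, abs_of_nonneg hT] using this
  have e1 := intervalIntegral_tendsto_integral (hint 0 (by simp)) tendsto_neg_atTop_atBot tendsto_id
  have e2 := intervalIntegral_tendsto_integral (hint 1 (by simp)) tendsto_neg_atTop_atBot tendsto_id
  have e3 := (hvert 1 (by simp)).const_mul Complex.I
  have e4 := (hvert (-1) (by simp)).const_mul Complex.I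
  have hlim := ((e1.sub e2).add e3).sub e4
  have hzero : ∀ T : ℝ, (∫ x in (-T)..T, H (x + (0 : ℝ) * Complex.I))
      - (∫ x in (-T)..T, H (x + (1 : ℝ) * Complex.I))
      + Complex.I * (∫ y : ℝ in (0 : ℝ)..1, H ((1 * T : ℝ) + y * Complex.I))
      - Complex.I * (∫ y : ℝ in (0 : ℝ)..1, H ((-1 * T : ℝ) + y * Complex.I)) = 0 := by
    intro T
    have := Complex.integral_boundary_rect_eq_zero_of_differentiableOn H ⟨-T, 0⟩ ⟨T, 1⟩
      (hd.mono fun s hs => by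
        have := (Complex.mem_reProdIm.1 hs).2
        simpa [Set.uIcc_of_le] using this)
    simpa using this
  have := tendsto_nhds_unique (hlim.congr fun T => hzero T) tendsto_const_nhds
  simp only [Complex.ofReal_zero, zero_mul, add_zero, mul_zero, sub_zero, Complex.ofReal_one,
    one_mul] at this
  exact sub_eq_zero.1 this

/-- Conjugating both the argument and the value preserves holomorphy. This makes the second factor
of the inner product holomorphic: the function equals `conj (g (x + i))` at `x` and `conj (g x)` at
`x + i`. -/
theorem differentiableOn_conj_conj_shift {g : ℂ → ℂ} {δ : ℝ}
    (hg : DifferentiableOn ℂ g (openStrip (1 + δ))) :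
    DifferentiableOn ℂ (fun s => conj (g (conj s + Complex.I)))
      {s | |s.im - 1| < 1 + δ} := by
  intro s hs
  have hopen : IsOpen (openStrip (1 + δ)) :=
    isOpen_lt (continuous_abs.comp Complex.continuous_im) continuous_const
  have hmem : conj s + Complex.I ∈ openStrip (1 + δ) := by
    simp only [openStrip, Set.mem_ofPred_eq, Complex.add_im, Complex.conj_im, Complex.I_im]
    rw [neg_add_eq_sub, abs_sub_comm]
    exact hs
  have h1 : DifferentiableAt ℂ g (conj s + Complex.I) :=
    (hg _ hmem).differentiableAt (hopen.mem_nhds hmem)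
  have h2 : DifferentiableAt ℂ (fun z => g (z + Complex.I)) (conj s) :=
    h1.comp (conj s) (f := fun z => z + Complex.I) (by fun_prop)
  have h3 := h2.conj_conj
  simp only [Complex.conj_conj] at h3
  exact h3.differentiableWithinAt

/-- The shift by `i` times a linear factor: passing to the other side of the inner product. -/
theorem stripSpace_integral_shift {f g : ℂ → ℂ} (hf : f ∈ stripSpace) (hg : g ∈ stripSpace)
    (a b : ℂ) :
    ∫ x : ℝ, (a * x + b) * f (x + Complex.I) * conj (g x)
      = ∫ x : ℝ, (a * (x - Complex.I) + b) * f x * conj (g (x + Complex.I)) := by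
  obtain ⟨⟨δ, hδ, hfd⟩, ε, hε, C, hC⟩ := hf
  obtain ⟨⟨δ', hδ', hgd⟩, ε', hε', C', hC'⟩ := hg
  -- Two factors of order `-3/2 - ε` and `-3/2 - ε'` against a linear one leave the order `-2 - ε -
  -- ε'`.
  have key := integral_eq_integral_add_I (p := 2 + ε + ε')
    (H := fun s => (a * (s - Complex.I) + b) * f s * conj (g (conj s + Complex.I)))
    (C := (‖a‖ + (‖a‖ + ‖b‖)) * 2 * |C| * |C'|) (by linarith) ?_ ?_
  · simp only [Complex.conj_ofReal, map_add, Complex.conj_I] at key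
    rw [key]
    simp
  · refine ((by fun_prop : Differentiable ℂ fun s : ℂ => a * (s - Complex.I) + b).differentiableOn.mul
      (hfd.mono ?_)).mul ((differentiableOn_conj_conj_shift hgd).mono ?_)
    · intro s hs
      have hs : 0 ≤ s.im ∧ s.im ≤ 1 := hs
      simp only [openStrip, Set.mem_ofPred_eq]
      rw [abs_lt]; constructor <;> linarith
    · intro s hs
      have hs : 0 ≤ s.im ∧ s.im ≤ 1 := hs
      simp only [Set.mem_ofPred_eq]
      rw [abs_lt]; constructor <;> linarith
  · intro s hs
    have hs : 0 ≤ s.im ∧ s.im ≤ 1 := hs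
    have h0 : (0 : ℝ) < 1 + |s.re| := by positivity
    have h1 : ‖a * (s - Complex.I) + b‖ ≤ (‖a‖ + (‖a‖ + ‖b‖)) * 2 * (1 + |s.re|) := by
      have hn : ‖s - Complex.I‖ ≤ 1 + |s.re| := by
        refine (Complex.norm_le_abs_re_add_abs_im _).trans ?_
        have : |s.im - 1| ≤ 1 := by rw [abs_le]; constructor <;> linarith
        simp only [Complex.sub_re, Complex.I_re, Complex.sub_im, Complex.I_im, sub_zero]
        linarith
      refine (norm_add_le _ _).trans ?_
      rw [norm_mul]
      have := mul_le_mul_of_nonneg_left hn (norm_nonneg a)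
      nlinarith [norm_nonneg a, norm_nonneg b, abs_nonneg s.re,
        mul_nonneg (norm_nonneg b) (abs_nonneg s.re), mul_nonneg (norm_nonneg a) (abs_nonneg s.re)]
    have h2 : ‖f s‖ ≤ |C| * (1 + |s.re|) ^ (-(3 / 2 : ℝ) - ε) := by
      refine (hC s (by rw [abs_le]; constructor <;> linarith)).trans ?_
      gcongr
      exact le_abs_self C
    have h3 : ‖conj (g (conj s + Complex.I))‖ ≤ |C'| * (1 + |s.re|) ^ (-(3 / 2 : ℝ) - ε') := by
      rw [RCLike.norm_conj]
      have := hC' (conj s + Complex.I) (by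
        simp only [Complex.add_im, Complex.conj_im, Complex.I_im]
        rw [abs_le]; constructor <;> linarith)
      simp only [Complex.add_re, Complex.conj_re, Complex.I_re, add_zero] at this
      refine this.trans ?_
      gcongr
      exact le_abs_self C'
    have h4 : (1 + |s.re|) ^ (-(2 + ε + ε')) = (1 + |s.re|) * (1 + |s.re|) ^ (-(3 / 2 : ℝ) - ε) *
        (1 + |s.re|) ^ (-(3 / 2 : ℝ) - ε') := by
      rw [← Real.rpow_one_add' h0.le (by linarith), ← Real.rpow_add h0]
      congr 1
      ring
    rw [norm_mul, norm_mul, h4]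
    calc _ ≤ ((‖a‖ + (‖a‖ + ‖b‖)) * 2 * (1 + |s.re|)) * (|C| * (1 + |s.re|) ^ (-(3 / 2 : ℝ) - ε)) *
          (|C'| * (1 + |s.re|) ^ (-(3 / 2 : ℝ) - ε')) := by gcongr
      _ = _ := by ring

theorem stripSpace_comp_neg {f : ℂ → ℂ} (hf : f ∈ stripSpace) : (fun s => f (-s)) ∈ stripSpace := by
  obtain ⟨⟨δ, hδ, hfd⟩, ε, hε, C, hC⟩ := hf
  refine ⟨⟨δ, hδ, hfd.comp (by fun_prop) fun s hs => ?_⟩, ε, hε, C, fun s hs => ?_⟩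
  · simpa [openStrip] using hs
  · simpa using hC (-s) (by simpa using hs)

/-- The reflection `s ↦ -s` preserves the space and exchanges the two shifts. -/
theorem stripSpace_integral_shift_neg {f g : ℂ → ℂ} (hf : f ∈ stripSpace) (hg : g ∈ stripSpace)
    (a b : ℂ) :
    ∫ x : ℝ, (a * x + b) * f (x - Complex.I) * conj (g x)
      = ∫ x : ℝ, (a * (x + Complex.I) + b) * f x * conj (g (x - Complex.I)) := by
  have h := stripSpace_integral_shift (stripSpace_comp_neg hf) (stripSpace_comp_neg hg) (-a) b
  have e1 := integral_neg_eq_self (fun x : ℝ => (a * x + b) * f (x - Complex.I) * conj (g x)) volume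
  have e2 := integral_neg_eq_self
    (fun x : ℝ => (a * (x + Complex.I) + b) * f x * conj (g (x - Complex.I))) volume
  rw [← e1, ← e2]
  convert h using 3 with x
  · push_cast; ring_nf
  · push_cast; ring_nf

theorem L2R_inner_toLp {f g : ℝ → ℂ} (hf : MemLp f 2 volume) (hg : MemLp g 2 volume) :
    ⟪(hf.toLp f : L2R), hg.toLp g⟫_ℂ = ∫ x, g x * conj (f x) := by
  rw [L2.inner_def]
  refine integral_congr_ae ?_
  filter_upwards [hf.coeFn_toLp, hg.coeFn_toLp] with x h1 h2
  rw [h1, h2]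
  rfl

theorem integrable_mul_conj {f g : ℝ → ℂ} (hf : MemLp f 2 volume) (hg : MemLp g 2 volume) :
    Integrable fun x => g x * conj (f x) := by
  have := L2.integrable_inner (𝕜 := ℂ) (hf.toLp f) (hg.toLp g)
  refine this.congr ?_
  filter_upwards [hf.coeFn_toLp, hg.coeFn_toLp] with x h1 h2
  rw [h1, h2]
  rfl

/-- The expression `(a s + b) f(s + i) + (c s + d) f(s) + (e s + h) f(s - i)`. -/
noncomputable def shiftExpr (a b c d e h : ℂ) (f : ℂ → ℂ) (s : ℂ) : ℂ :=
  (a * s + b) * f (s + Complex.I) + (c * s + d) * f s + (e * s + h) * f (s - Complex.I)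

theorem stripSpace_memLp_shift_I {f : ℂ → ℂ} (hf : f ∈ stripSpace) (a b : ℂ) :
    MemLp (fun x : ℝ => (a * x + b) * f (x + Complex.I)) 2 volume :=
  stripSpace_memLp_shift hf (by simp) (by simp) a b

theorem stripSpace_memLp_mul {f : ℂ → ℂ} (hf : f ∈ stripSpace) (a b : ℂ) :
    MemLp (fun x : ℝ => (a * x + b) * f x) 2 volume := by
  simpa using stripSpace_memLp_shift hf (c := 0) (by simp) (by simp) a b

theorem stripSpace_memLp_shift_neg_I {f : ℂ → ℂ} (hf : f ∈ stripSpace) (a b : ℂ) :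
    MemLp (fun x : ℝ => (a * x + b) * f (x - Complex.I)) 2 volume := by
  simpa [sub_eq_add_neg] using stripSpace_memLp_shift hf (c := -Complex.I) (by simp) (by simp) a b

theorem shiftExpr_memLp {f : ℂ → ℂ} (hf : f ∈ stripSpace) (a b c d e h : ℂ) :
    MemLp (fun x : ℝ => shiftExpr a b c d e h f x) 2 volume :=
  ((stripSpace_memLp_shift_I hf a b).add (stripSpace_memLp_mul hf c d)).add
    (stripSpace_memLp_shift_neg_I hf e h)

theorem shiftExpr_integral {f g : ℂ → ℂ} (hf : f ∈ stripSpace) (hg : g ∈ stripSpace)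
    (a b c d e h : ℂ) :
    ∫ x : ℝ, shiftExpr a b c d e h f x * conj (g x)
      = ∫ x : ℝ, f x * conj (shiftExpr (conj a) (conj (b - a * Complex.I)) (conj c) (conj d)
        (conj e) (conj (h + e * Complex.I)) g x) := by
  have i1 := integrable_mul_conj (stripSpace_memLp hg) (stripSpace_memLp_shift_I hf a b)
  have i2 := integrable_mul_conj (stripSpace_memLp hg) (stripSpace_memLp_mul hf c d)
  have i3 := integrable_mul_conj (stripSpace_memLp hg) (stripSpace_memLp_shift_neg_I hf e h)
  have j1 := integrable_mul_conj
    (stripSpace_memLp_shift_I hg (conj a) (conj (b - a * Complex.I))) (stripSpace_memLp hf)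
  have j2 := integrable_mul_conj
    (stripSpace_memLp_mul hg (conj c) (conj d)) (stripSpace_memLp hf)
  have j3 := integrable_mul_conj
    (stripSpace_memLp_shift_neg_I hg (conj e) (conj (h + e * Complex.I))) (stripSpace_memLp hf)
  have hl := integral_add (i1.add i2) i3
  have hr := integral_add (j1.add j2) j3
  rw [integral_add' i1 i2] at hl
  rw [integral_add' j1 j2] at hr
  rw [stripSpace_integral_shift hf hg, stripSpace_integral_shift_neg hf hg] at hl
  have k1 : ∫ x : ℝ, (a * (x - Complex.I) + b) * f x * conj (g (x + Complex.I))
      = ∫ x : ℝ, f x * conj ((conj a * x + conj (b - a * Complex.I)) * g (x + Complex.I)) :=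
    integral_congr_ae (Eventually.of_forall fun x => by simp; ring)
  have k2 : ∫ x : ℝ, (c * x + d) * f x * conj (g x)
      = ∫ x : ℝ, f x * conj ((conj c * x + conj d) * g x) :=
    integral_congr_ae (Eventually.of_forall fun x => by simp; ring)
  have k3 : ∫ x : ℝ, (e * (x + Complex.I) + h) * f x * conj (g (x - Complex.I))
      = ∫ x : ℝ, f x * conj ((conj e * x + conj (h + e * Complex.I)) * g (x - Complex.I)) :=
    integral_congr_ae (Eventually.of_forall fun x => by simp; ring)
  rw [k1, k2, k3] at hl
  refine Eq.trans ?_ (hl.trans (hr.symm.trans ?_)) <;>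
    refine integral_congr_ae (Eventually.of_forall fun x => ?_) <;>
    simp only [shiftExpr, Pi.add_apply, map_add] <;> ring

theorem diffExpr_eq_shiftExpr (τ φ : ℝ) (f : ℂ → ℂ) :
    diffExpr τ φ f = shiftExpr 1 (Complex.I / 2) (2 * Real.cos φ) (-2 * τ * Real.cos φ)
      1 (-Complex.I / 2 - 2 * τ) f := by
  ext s
  simp only [diffExpr, shiftExpr]
  linear_combination (s * f (s + Complex.I) + (s - 2 * τ) * f (s - Complex.I)) *
    (-Complex.I_mul_I)

/-- The constant coefficient part `f(s + i) + 2 cos φ f(s) + f(s - i)`. -/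
noncomputable def leadExpr (φ : ℝ) : (ℂ → ℂ) → ℂ → ℂ := shiftExpr 0 1 0 (2 * Real.cos φ) 0 1

/-- Transposition replaces the constant terms `b`, `h` by `conj (b - i)`, `conj (h + i)`; the values
`i/2` and `-i/2 - 2τ` are fixed by these maps, and the middle coefficient is real on the real line.
-/
theorem diffExpr_integral (τ φ : ℝ) {f g : ℂ → ℂ} (hf : f ∈ stripSpace) (hg : g ∈ stripSpace) :
    ∫ x : ℝ, diffExpr τ φ f x * conj (g x) = ∫ x : ℝ, f x * conj (diffExpr τ φ g x) := by
  simp only [diffExpr_eq_shiftExpr]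
  rw [shiftExpr_integral hf hg]
  refine integral_congr_ae (Eventually.of_forall fun x => ?_)
  simp [shiftExpr, -Complex.ofReal_cos, Complex.conj_ofNat]
  ring_nf
  simp

theorem leadExpr_integral (φ : ℝ) {f g : ℂ → ℂ} (hf : f ∈ stripSpace) (hg : g ∈ stripSpace) :
    ∫ x : ℝ, leadExpr φ f x * conj (g x) = ∫ x : ℝ, f x * conj (leadExpr φ g x) := by
  simp only [leadExpr]
  rw [shiftExpr_integral hf hg]
  refine integral_congr_ae (Eventually.of_forall fun x => ?_)
  simp [shiftExpr, -Complex.ofReal_cos, Complex.conj_ofNat]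

theorem inner_stripDiff (τ φ : ℝ) (f g : stripSpace) :
    ⟪stripDiff τ φ f, stripRestrict g⟫_ℂ = ⟪stripRestrict f, stripDiff τ φ g⟫_ℂ := by
  have := L2R_inner_toLp (diffExpr_memLp τ φ f.2) (stripSpace_memLp g.2)
  have h2 := L2R_inner_toLp (stripSpace_memLp f.2) (diffExpr_memLp τ φ g.2)
  rw [diffExpr_integral τ φ g.2 f.2] at h2
  exact this.trans h2.symm

/-! ### Fourier–Laplace integrals of test functions. -/

/-- The Fourier–Laplace integral `∫ φ(ξ) exp(2πi s ξ) dξ`. -/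
noncomputable def fourierLaplace (φ : ℝ → ℂ) (s : ℂ) : ℂ :=
  ∫ ξ : ℝ, Complex.exp (2 * Real.pi * Complex.I * s * ξ) * φ ξ

theorem fourierLaplace_integrable {φ : ℝ → ℂ} (hφ : Continuous φ) (hc : HasCompactSupport φ)
    (s : ℂ) : Integrable fun ξ : ℝ => Complex.exp (2 * Real.pi * Complex.I * s * ξ) * φ ξ :=
  Continuous.integrable_of_hasCompactSupport (by fun_prop) hc.mul_left

theorem norm_exp_two_pi_I_mul (s : ℂ) (ξ : ℝ) :
    ‖Complex.exp (2 * Real.pi * Complex.I * s * ξ)‖ = Real.exp (-(2 * Real.pi * s.im * ξ)) := by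
  rw [Complex.norm_exp]
  congr 1
  simp

theorem norm_exp_two_pi_I_mul_le {s : ℂ} {R : ℝ} (hs : |s.im| ≤ R) (ξ : ℝ) :
    ‖Complex.exp (2 * Real.pi * Complex.I * s * ξ)‖ ≤ Real.exp (2 * Real.pi * R * |ξ|) := by
  rw [norm_exp_two_pi_I_mul]
  gcongr
  refine (neg_le_abs _).trans ?_
  rw [abs_mul, abs_mul, abs_of_pos Real.two_pi_pos]
  gcongr

theorem differentiable_fourierLaplace {φ : ℝ → ℂ} (hφ : Continuous φ) (hc : HasCompactSupport φ) :
    Differentiable ℂ (fourierLaplace φ) := by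
  intro s₀
  refine (hasDerivAt_integral_of_dominated_loc_of_deriv_le
    (F := fun (s : ℂ) (ξ : ℝ) => Complex.exp (2 * Real.pi * Complex.I * s * ξ) * φ ξ)
    (F' := fun (s : ℂ) (ξ : ℝ) =>
      2 * Real.pi * Complex.I * ξ * Complex.exp (2 * Real.pi * Complex.I * s * ξ) * φ ξ)
    -- On the unit ball about `s₀` the imaginary part is at most `|s₀.im| + 1`; compact support
    -- makes the bound integrable.
    (bound := fun ξ => 2 * Real.pi * |ξ| * Real.exp (2 * Real.pi * (|s₀.im| + 1) * |ξ|) * ‖φ ξ‖)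
    (Metric.ball_mem_nhds s₀ one_pos) ?_ (fourierLaplace_integrable hφ hc s₀) ?_ ?_ ?_ ?_
    ).2.differentiableAt
  · exact Eventually.of_forall fun s => (by fun_prop : Continuous _).aestronglyMeasurable
  · exact (by fun_prop : Continuous _).aestronglyMeasurable
  · refine Eventually.of_forall fun ξ s hs => ?_
    rw [norm_mul, norm_mul]
    have h1 : ‖2 * (Real.pi : ℂ) * Complex.I * ξ‖ = 2 * Real.pi * |ξ| := by
      simp [abs_of_pos Real.pi_pos]
    have h2 : |s.im| ≤ |s₀.im| + 1 := by
      have h3 : |(s - s₀).im| ≤ 1 :=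
        (Complex.abs_im_le_norm _).trans (by simpa [dist_eq_norm] using (Metric.mem_ball.1 hs).le)
      have := abs_add_le s₀.im (s - s₀).im
      simp only [Complex.sub_im, add_sub_cancel] at this h3
      linarith
    rw [h1]
    gcongr
    exact norm_exp_two_pi_I_mul_le h2 ξ
  · exact Continuous.integrable_of_hasCompactSupport (by fun_prop) hc.norm.mul_left
  · refine Eventually.of_forall fun ξ s _ => ?_
    have h1 : HasDerivAt (fun s : ℂ => 2 * Real.pi * Complex.I * s * ξ)
        (2 * Real.pi * Complex.I * ξ) s := by
      have := ((hasDerivAt_id s).const_mul (2 * (Real.pi : ℂ) * Complex.I)).mul_const (ξ : ℂ)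
      simpa using this
    have h2 := h1.cexp.mul_const (φ ξ)
    exact h2.congr_deriv (by ring)

theorem fourierLaplace_mul_left {φ : ℝ → ℂ} (hφ : ContDiff ℝ ∞ φ) (hc : HasCompactSupport φ)
    (s : ℂ) :
    s * fourierLaplace φ s = fourierLaplace (fun ξ => Complex.I / (2 * Real.pi) * deriv φ ξ) s := by
  have hφd : Continuous (deriv φ) := hφ.continuous_deriv (by simp)
  have hder : ∀ ξ : ℝ, HasDerivAt (fun ξ : ℝ => Complex.exp (2 * Real.pi * Complex.I * s * ξ))
      (2 * Real.pi * Complex.I * s * Complex.exp (2 * Real.pi * Complex.I * s * ξ)) ξ := by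
    intro ξ
    have h1 : HasDerivAt (fun ξ : ℝ => 2 * Real.pi * Complex.I * s * (ξ : ℂ))
        (2 * Real.pi * Complex.I * s) ξ := by
      simpa using (Complex.ofRealCLM.hasDerivAt (x := ξ)).const_mul (2 * Real.pi * Complex.I * s)
    exact h1.cexp.congr_deriv (mul_comm _ _)
  have hparts := integral_mul_deriv_eq_deriv_mul_of_integrable (v := φ) (v' := deriv φ)
    (fun x _ => hder x)
    (fun x _ => (hφ.differentiable (by simp) x).hasDerivAt)
    (fourierLaplace_integrable hφd hc.deriv s)
    (Continuous.integrable_of_hasCompactSupport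
      (by have := hφ.continuous; fun_prop) hc.mul_left)
    (fourierLaplace_integrable hφ.continuous hc s)
  simp only [fourierLaplace]
  have h2 : ∫ ξ : ℝ, Complex.exp (2 * Real.pi * Complex.I * s * ξ) *
      (Complex.I / (2 * Real.pi) * deriv φ ξ) = Complex.I / (2 * Real.pi) *
      ∫ ξ : ℝ, Complex.exp (2 * Real.pi * Complex.I * s * ξ) * deriv φ ξ := by
    rw [← integral_const_mul]
    congr 1
    ext ξ
    ring
  have h3 : ∫ ξ : ℝ, 2 * Real.pi * Complex.I * s * Complex.exp (2 * Real.pi * Complex.I * s * ξ)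
      * φ ξ = 2 * Real.pi * Complex.I * s *
      ∫ ξ : ℝ, Complex.exp (2 * Real.pi * Complex.I * s * ξ) * φ ξ := by
    rw [← integral_const_mul]
    congr 1
    ext ξ
    ring
  rw [h2, hparts, h3]
  have hpi : (Real.pi : ℂ) ≠ 0 := by exact_mod_cast Real.pi_ne_zero
  have hI := Complex.I_sq
  field_simp
  rw [hI]
  ring

theorem norm_fourierLaplace_le (φ : ℝ → ℂ) {s : ℂ} (hφ : Continuous φ) (hc : HasCompactSupport φ)
    (hs : |s.im| ≤ 1) :
    ‖fourierLaplace φ s‖ ≤ ∫ ξ : ℝ, Real.exp (2 * Real.pi * 1 * |ξ|) * ‖φ ξ‖ := by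
  refine norm_integral_le_of_norm_le
    (Continuous.integrable_of_hasCompactSupport (by fun_prop) hc.norm.mul_left)
    (Eventually.of_forall fun ξ => ?_)
  rw [norm_mul]
  gcongr
  exact norm_exp_two_pi_I_mul_le hs ξ

/-- Two integrations by parts bound `s²` times the integral uniformly on the strip, giving decay of
order `-2 = -3/2 - 1/2`. -/
theorem fourierLaplace_mem {φ : ℝ → ℂ} (hφ : ContDiff ℝ ∞ φ) (hc : HasCompactSupport φ) :
    fourierLaplace φ ∈ stripSpace := by
  refine ⟨⟨1, one_pos, (differentiable_fourierLaplace hφ.continuous hc).differentiableOn⟩,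
    1 / 2, by norm_num, ?_⟩
  have hφ' : ContDiff ℝ ∞ (deriv φ) := (contDiff_infty_iff_deriv.1 hφ).2
  set c : ℂ := Complex.I / (2 * Real.pi)
  have hφ1 : ContDiff ℝ ∞ fun ξ => c * deriv φ ξ := contDiff_const.mul hφ'
  have hc1 : HasCompactSupport fun ξ => c * deriv φ ξ := hc.deriv.mul_left
  have hφ2 : ContDiff ℝ ∞ fun ξ => c * deriv (fun ξ => c * deriv φ ξ) ξ :=
    contDiff_const.mul (contDiff_infty_iff_deriv.1 hφ1).2
  have hc2 : HasCompactSupport fun ξ => c * deriv (fun ξ => c * deriv φ ξ) ξ := hc1.deriv.mul_left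
  set φ2 := fun ξ => c * deriv (fun ξ => c * deriv φ ξ) ξ
  refine ⟨2 * (∫ ξ : ℝ, Real.exp (2 * Real.pi * 1 * |ξ|) * ‖φ ξ‖) +
    2 * (∫ ξ : ℝ, Real.exp (2 * Real.pi * 1 * |ξ|) * ‖φ2 ξ‖), fun s hs => ?_⟩
  have b1 := norm_fourierLaplace_le φ hφ.continuous hc hs
  have b2 := norm_fourierLaplace_le φ2 hφ2.continuous hc2 hs
  have e : s * (s * fourierLaplace φ s) = fourierLaplace φ2 s := by
    rw [fourierLaplace_mul_left hφ hc, fourierLaplace_mul_left hφ1 hc1]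
  rw [← e, norm_mul, norm_mul] at b2
  have h0 : (0 : ℝ) < 1 + |s.re| := by positivity
  have hr := Complex.abs_re_le_norm s
  rw [show -(3 / 2 : ℝ) - 1 / 2 = ((-2 : ℤ) : ℝ) by norm_num, Real.rpow_intCast, zpow_neg,
    ← div_eq_mul_inv, le_div_iff₀ (by positivity)]
  have h4 : (1 + |s.re|) ^ (2 : ℤ) ≤ 2 + 2 * (‖s‖ * ‖s‖) := by
    rw [zpow_ofNat]
    nlinarith [sq_nonneg (1 - |s.re|), abs_nonneg s.re]
  calc _ ≤ ‖fourierLaplace φ s‖ * (2 + 2 * (‖s‖ * ‖s‖)) := by gcongr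
    _ = 2 * ‖fourierLaplace φ s‖ + 2 * (‖s‖ * (‖s‖ * ‖fourierLaplace φ s‖)) := by ring
    _ ≤ _ := by gcongr

theorem fourierLaplace_add_I (φ : ℝ → ℂ) (s : ℂ) :
    fourierLaplace φ (s + Complex.I)
      = fourierLaplace (fun ξ => Complex.exp (-(2 * Real.pi * ξ)) * φ ξ) s := by
  simp only [fourierLaplace]
  congr 1
  ext ξ
  rw [← mul_assoc, ← Complex.exp_add]
  congr 2
  linear_combination 2 * Real.pi * ξ * Complex.I_mul_I

theorem fourierLaplace_sub_I (φ : ℝ → ℂ) (s : ℂ) :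
    fourierLaplace φ (s - Complex.I)
      = fourierLaplace (fun ξ => Complex.exp (2 * Real.pi * ξ) * φ ξ) s := by
  simp only [fourierLaplace]
  congr 1
  ext ξ
  rw [← mul_assoc, ← Complex.exp_add]
  congr 2
  linear_combination -2 * Real.pi * ξ * Complex.I_mul_I

theorem fourierLaplace_const_mul (c : ℂ) (φ : ℝ → ℂ) (s : ℂ) :
    c * fourierLaplace φ s = fourierLaplace (fun ξ => c * φ ξ) s := by
  simp only [fourierLaplace, ← integral_const_mul]
  congr 1
  ext ξ
  ring

theorem fourierLaplace_add {φ ψ : ℝ → ℂ} (hφ : Continuous φ) (hc : HasCompactSupport φ)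
    (hψ : Continuous ψ) (hd : HasCompactSupport ψ) (s : ℂ) :
    fourierLaplace φ s + fourierLaplace ψ s = fourierLaplace (fun ξ => φ ξ + ψ ξ) s := by
  simp only [fourierLaplace]
  rw [← integral_add (fourierLaplace_integrable hφ hc s) (fourierLaplace_integrable hψ hd s)]
  congr 1
  ext ξ
  ring

theorem memLp_of_hasCompactSupport {φ : ℝ → ℂ} (hφ : Continuous φ) (hc : HasCompactSupport φ) :
    MemLp φ 2 volume :=
  hφ.memLp_of_hasCompactSupport hc

/-- On the real line the Fourier–Laplace integral is the inverse Fourier transform. -/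
theorem fourier_toLp_fourierLaplace {φ : ℝ → ℂ} (hφ : ContDiff ℝ ∞ φ) (hc : HasCompactSupport φ)
    (hm : MemLp (fun x : ℝ => fourierLaplace φ x) 2 volume) :
    𝓕 (hm.toLp _ : L2R) = ((memLp_of_hasCompactSupport hφ.continuous hc).toLp φ : L2R) := by
  set Φ := hc.toSchwartzMap hφ
  have h1 : (hm.toLp _ : L2R) = (𝓕⁻ Φ).toLp 2 := by
    refine Lp.ext ?_
    refine hm.coeFn_toLp.trans (((𝓕⁻ Φ).coeFn_toLp 2).trans (Eventually.of_forall fun x => ?_)).symm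
    rw [SchwartzMap.fourierInv_coe, Real.fourierInv_eq']
    simp only [fourierLaplace]
    congr 1
    ext ξ
    rw [smul_eq_mul]
    congr 2
    simp
    ring
  have h2 : ((memLp_of_hasCompactSupport hφ.continuous hc).toLp φ : L2R) = Φ.toLp 2 :=
    Lp.ext (((memLp_of_hasCompactSupport hφ.continuous hc).coeFn_toLp).trans
      (Φ.coeFn_toLp 2).symm)
  rw [h1, h2, ← SchwartzMap.toLp_fourierInv_eq]
  exact FourierTransform.fourier_fourierInv_eq _

/-! ### The operator on the Fourier side. -/

/-- The leading coefficient `2 cosh 2πξ + 2 cos φ` of the operator on the Fourier side. -/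
noncomputable def leadCoeff (φ ξ : ℝ) : ℝ := 2 * Real.cosh (2 * Real.pi * ξ) + 2 * Real.cos φ

/-- The potential `2τ (cos φ + exp 2πξ)` of the operator on the Fourier side. -/
noncomputable def potential (τ φ ξ : ℝ) : ℝ := 2 * τ * (Real.cos φ + Real.exp (2 * Real.pi * ξ))

/-- The first order differential operator `(i / 2π) (w ψ' + w' ψ / 2) - r ψ`, the image of the
difference expression under the Fourier transform; here `w = leadCoeff φ`,
`r = potential τ φ`. -/
noncomputable def fourierSideOp (τ φ : ℝ) (ψ : ℝ → ℂ) (ξ : ℝ) : ℂ :=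
  Complex.I / (2 * Real.pi) * leadCoeff φ ξ * deriv ψ ξ
    + (Complex.I * Real.sinh (2 * Real.pi * ξ) - potential τ φ ξ) * ψ ξ

theorem contDiff_leadCoeff (φ : ℝ) : ContDiff ℝ ∞ (leadCoeff φ) := by
  unfold leadCoeff
  fun_prop

theorem continuous_leadCoeff (φ : ℝ) : Continuous (leadCoeff φ) := (contDiff_leadCoeff φ).continuous

theorem contDiff_potential (τ φ : ℝ) : ContDiff ℝ ∞ (potential τ φ) := by
  unfold potential
  fun_prop

theorem continuous_potential (τ φ : ℝ) : Continuous (potential τ φ) :=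
  (contDiff_potential τ φ).continuous

theorem HasCompactSupport.fun_add {f g : ℝ → ℂ} (hf : HasCompactSupport f)
    (hg : HasCompactSupport g) : HasCompactSupport fun ξ => f ξ + g ξ :=
  hf.add hg

theorem hasDerivAt_leadCoeff (φ ξ : ℝ) :
    HasDerivAt (leadCoeff φ) (2 * (2 * Real.pi) * Real.sinh (2 * Real.pi * ξ)) ξ := by
  have h1 : HasDerivAt (fun ξ : ℝ => 2 * Real.pi * ξ) (2 * Real.pi) ξ := by
    simpa using (hasDerivAt_id ξ).const_mul (2 * Real.pi)
  exact ((h1.cosh.const_mul 2).add_const (2 * Real.cos φ)).congr_deriv (by ring)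

theorem hasCompactSupport_fourierSideOp (τ φ : ℝ) {ψ : ℝ → ℂ} (hc : HasCompactSupport ψ) :
    HasCompactSupport (fourierSideOp τ φ ψ) :=
  (hc.deriv.mul_left (f := fun ξ => Complex.I / (2 * Real.pi) * leadCoeff φ ξ)).add
    (hc.mul_left (f := fun ξ => Complex.I * Real.sinh (2 * Real.pi * ξ) - potential τ φ ξ))

theorem contDiff_fourierSideOp (τ φ : ℝ) {ψ : ℝ → ℂ} (hψ : ContDiff ℝ ∞ ψ) :
    ContDiff ℝ ∞ (fourierSideOp τ φ ψ) := by
  have h1 := Complex.ofRealCLM.contDiff.comp (contDiff_leadCoeff φ)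
  have h2 := Complex.ofRealCLM.contDiff.comp (contDiff_potential τ φ)
  have h3 : ContDiff ℝ ∞ fun ξ : ℝ => Real.sinh (2 * Real.pi * ξ) := by fun_prop
  have h4 := Complex.ofRealCLM.contDiff.comp h3
  have h5 := (contDiff_infty_iff_deriv.1 hψ).2
  exact ((contDiff_const.mul h1).mul h5).add (((contDiff_const.mul h4).sub h2).mul hψ)

theorem leadExpr_fourierLaplace (φ : ℝ) {ψ : ℝ → ℂ} (hψ : ContDiff ℝ ∞ ψ)
    (hc : HasCompactSupport ψ) (s : ℂ) :
    leadExpr φ (fourierLaplace ψ) s = fourierLaplace (fun ξ => leadCoeff φ ξ * ψ ξ) s := by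
  have hψc := hψ.continuous
  simp only [leadExpr, shiftExpr, zero_mul, zero_add, one_mul]
  have c₁ : HasCompactSupport fun ξ : ℝ => Complex.exp (-(2 * Real.pi * ξ)) * ψ ξ := hc.mul_left
  have c₂ : HasCompactSupport fun ξ : ℝ => 2 * (Real.cos φ : ℂ) * ψ ξ := hc.mul_left
  have c₃ : HasCompactSupport fun ξ : ℝ => Complex.exp (2 * Real.pi * ξ) * ψ ξ := hc.mul_left
  rw [fourierLaplace_add_I, fourierLaplace_sub_I, fourierLaplace_const_mul,
    fourierLaplace_add (by fun_prop) c₁ (by fun_prop) c₂,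
    fourierLaplace_add (by fun_prop) (HasCompactSupport.fun_add c₁ c₂) (by fun_prop) c₃]
  congr 1
  ext ξ
  rw [leadCoeff, Real.cosh_eq]
  push_cast
  ring_nf

/-- The shift acts first and the factor `s` second, so the derivative also falls on `exp(∓2πξ)`;
those terms combine with the constants `±i/2` to give `i sinh 2πξ`, which is the half derivative of
`w` needed for symmetry. -/
theorem diffExpr_fourierLaplace (τ φ : ℝ) {ψ : ℝ → ℂ} (hψ : ContDiff ℝ ∞ ψ)
    (hc : HasCompactSupport ψ) (s : ℂ) :
    diffExpr τ φ (fourierLaplace ψ) s = fourierLaplace (fourierSideOp τ φ ψ) s := by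
  set e₁ : ℝ → ℂ := fun ξ => Complex.exp (-(2 * Real.pi * ξ)) with he₁
  set e₂ : ℝ → ℂ := fun ξ => Complex.exp (2 * Real.pi * ξ) with he₂
  have d₂ : ∀ ξ, HasDerivAt e₂ (2 * Real.pi * e₂ ξ) ξ := fun ξ => by
    have h1 : HasDerivAt (fun ξ : ℝ => 2 * Real.pi * (ξ : ℂ)) (2 * Real.pi) ξ := by
      simpa using (Complex.ofRealCLM.hasDerivAt (x := ξ)).const_mul (2 * Real.pi : ℂ)
    exact h1.cexp.congr_deriv (mul_comm _ _)
  have d₁ : ∀ ξ, HasDerivAt e₁ (-(2 * Real.pi * e₁ ξ)) ξ := fun ξ => by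
    have h1 : HasDerivAt (fun ξ : ℝ => -(2 * Real.pi * (ξ : ℂ))) (-(2 * Real.pi)) ξ := by
      simpa using ((Complex.ofRealCLM.hasDerivAt (x := ξ)).const_mul (2 * Real.pi : ℂ)).fun_neg
    exact h1.cexp.congr_deriv (by simp only [he₁]; ring)
  have s₀ : ContDiff ℝ ∞ fun ξ : ℝ => (ξ : ℂ) := Complex.ofRealCLM.contDiff
  have s₁ : ContDiff ℝ ∞ e₁ := (contDiff_const.mul s₀).neg.cexp
  have s₂ : ContDiff ℝ ∞ e₂ := (contDiff_const.mul s₀).cexp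
  have hψd := (contDiff_infty_iff_deriv.1 hψ).2.continuous
  have hψc := hψ.continuous
  have f₁ : ContDiff ℝ ∞ fun ξ => e₁ ξ * ψ ξ := s₁.mul hψ
  have f₂ : ContDiff ℝ ∞ fun ξ => e₂ ξ * ψ ξ := s₂.mul hψ
  have c₁ : HasCompactSupport fun ξ => e₁ ξ * ψ ξ := hc.mul_left
  have c₂ : HasCompactSupport fun ξ => e₂ ξ * ψ ξ := hc.mul_left
  have g₁ := (contDiff_infty_iff_deriv.1 f₁).2.continuous
  have g₂ := (contDiff_infty_iff_deriv.1 f₂).2.continuous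
  have k₁ := f₁.continuous
  have k₂ := f₂.continuous
  have ha : ∀ (a b : ℂ) {χ : ℝ → ℂ}, ContDiff ℝ ∞ χ → HasCompactSupport χ →
      (a * s + b) * fourierLaplace χ s = fourierLaplace
        (fun ξ => a * (Complex.I / (2 * Real.pi) * deriv χ ξ) + b * χ ξ) s := by
    intro a b χ hχ hcχ
    have hd := (contDiff_infty_iff_deriv.1 hχ).2.continuous
    have hcont := hχ.continuous
    have k₁ : HasCompactSupport fun ξ => a * (Complex.I / (2 * Real.pi) * deriv χ ξ) :=
      (hcχ.deriv.mul_left (f := fun _ => Complex.I / (2 * Real.pi))).mul_left (f := fun _ => a)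
    have k₂ : HasCompactSupport fun ξ => b * χ ξ := hcχ.mul_left
    rw [add_mul, mul_assoc, fourierLaplace_mul_left hχ hcχ, fourierLaplace_const_mul,
      fourierLaplace_const_mul, fourierLaplace_add (by fun_prop) k₁ (by fun_prop) k₂]
  have hcs : ∀ (a b : ℂ) {χ : ℝ → ℂ}, HasCompactSupport χ → HasCompactSupport
        (fun ξ => a * (Complex.I / (2 * Real.pi) * deriv χ ξ) + b * χ ξ) := fun a b χ h =>
    ((h.deriv.mul_left (f := fun _ => Complex.I / (2 * Real.pi))).mul_left (f := fun _ => a)).add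
      (h.mul_left (f := fun _ => b))
  rw [diffExpr_eq_shiftExpr, shiftExpr, fourierLaplace_add_I, fourierLaplace_sub_I,
    ha _ _ f₁ c₁, ha _ _ hψ hc, ha _ _ f₂ c₂,
    fourierLaplace_add (by fun_prop) (hcs _ _ c₁) (by fun_prop) (hcs _ _ hc),
    fourierLaplace_add (by fun_prop) (HasCompactSupport.fun_add (hcs _ _ c₁) (hcs _ _ hc))
      (by fun_prop) (hcs _ _ c₂)]
  congr 1
  ext ξ
  have hd := (hψ.differentiable (by simp) ξ).hasDerivAt
  rw [((d₁ ξ).fun_mul hd).deriv, ((d₂ ξ).fun_mul hd).deriv]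
  have h1 : ((Real.exp (2 * Real.pi * ξ) : ℝ) : ℂ) = e₂ ξ := by simp [he₂]
  have h2 : ((Real.exp (-(2 * Real.pi * ξ)) : ℝ) : ℂ) = e₁ ξ := by simp [he₁]
  have hpi : (Real.pi : ℂ) ≠ 0 := by exact_mod_cast Real.pi_ne_zero
  rw [fourierSideOp, leadCoeff, potential, Real.cosh_eq, Real.sinh_eq]
  push_cast [-Complex.ofReal_exp, -Complex.ofReal_cos]
  rw [h1, h2]
  field_simp
  ring

/-- Since `cosh 2x = 1 + 2 sinh² x` and `|sinh x| ≥ |x|`, `cosh 2πξ ≥ 1 + ξ²`. A quadratic lower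
bound is enough for `1/w` to be integrable. -/
theorem leadCoeff_ge (φ ξ : ℝ) :
    2 * (1 - |Real.cos φ|) * (1 + ξ ^ 2) ≤ leadCoeff φ ξ := by
  have h1 : 1 + ξ ^ 2 ≤ Real.cosh (2 * Real.pi * ξ) := by
    have hs : |Real.pi * ξ| ≤ |Real.sinh (Real.pi * ξ)| := by
      rw [Real.abs_sinh]
      exact Real.self_le_sinh_iff.2 (abs_nonneg _)
    have h2 := sq_le_sq.2 hs
    have h3 : Real.cosh (2 * (Real.pi * ξ)) = 1 + 2 * Real.sinh (Real.pi * ξ) ^ 2 := by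
      rw [Real.cosh_two_mul, Real.cosh_sq]; ring
    rw [mul_assoc, h3]
    have hpi : 1 ≤ Real.pi ^ 2 := by nlinarith [Real.pi_gt_three]
    nlinarith [mul_le_mul_of_nonneg_right hpi (sq_nonneg ξ)]
  have h4 := abs_le.1 (le_refl |Real.cos φ|)
  have h5 := Real.abs_cos_le_one φ
  unfold leadCoeff
  nlinarith [mul_le_mul_of_nonneg_left h1 (sub_nonneg.2 h5), abs_nonneg (Real.cos φ), sq_nonneg ξ,
    mul_nonneg (abs_nonneg (Real.cos φ)) (sub_nonneg.2 (Real.one_le_cosh (2 * Real.pi * ξ)))]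

theorem abs_cos_lt_one {φ : ℝ} (hφ₀ : 0 < φ) (hφπ : φ < Real.pi) : |Real.cos φ| < 1 := by
  have := Real.sin_pos_of_pos_of_lt_pi hφ₀ hφπ
  have h2 := Real.sin_sq_add_cos_sq φ
  rw [← sq_lt_one_iff_abs_lt_one]
  nlinarith

theorem leadCoeff_pos {φ : ℝ} (hφ : |Real.cos φ| < 1) (ξ : ℝ) : 0 < leadCoeff φ ξ :=
  lt_of_lt_of_le (mul_pos (by linarith) (by positivity)) (leadCoeff_ge φ ξ)

theorem integrable_inv_leadCoeff {φ : ℝ} (hφ : |Real.cos φ| < 1) :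
    Integrable fun ξ => (leadCoeff φ ξ)⁻¹ := by
  refine (integrable_inv_one_add_sq.const_mul (2 * (1 - |Real.cos φ|))⁻¹).mono'
    ((continuous_leadCoeff φ).inv₀ fun ξ => (leadCoeff_pos hφ ξ).ne').aestronglyMeasurable
    (Eventually.of_forall fun ξ => ?_)
  have h : 0 < 2 * (1 - |Real.cos φ|) * (1 + ξ ^ 2) := mul_pos (by linarith) (by positivity)
  rw [Real.norm_eq_abs, abs_of_pos (inv_pos.2 (leadCoeff_pos hφ ξ)), ← mul_inv]
  exact inv_anti₀ h (leadCoeff_ge φ ξ)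

theorem hasDerivAt_integral_zero {f : ℝ → ℝ} (hf : Continuous f) (x : ℝ) :
    HasDerivAt (fun x => ∫ t in (0 : ℝ)..x, f t) (f x) x :=
  intervalIntegral.integral_hasDerivAt_right (hf.intervalIntegrable _ _)
    (hf.stronglyMeasurableAtFilter _ _) hf.continuousAt

theorem contDiff_integral_zero {f : ℝ → ℝ} (hf : ContDiff ℝ ∞ f) :
    ContDiff ℝ ∞ fun x => ∫ t in (0 : ℝ)..x, f t := by
  refine contDiff_infty_iff_deriv.2
    ⟨fun x => (hasDerivAt_integral_zero hf.continuous x).differentiableAt, ?_⟩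
  rwa [funext fun x => (hasDerivAt_integral_zero hf.continuous x).deriv]

/-! ### Solutions of the eigenvalue equation. -/

/-- The exponent `-2πi ∫₀ (z + r) / w` of a solution of the eigenvalue equation. -/
noncomputable def eigenPhase (τ φ : ℝ) (z : ℂ) (ξ : ℝ) : ℂ :=
  -(2 * Real.pi * Complex.I) * (z * (∫ t in (0 : ℝ)..ξ, (leadCoeff φ t)⁻¹ : ℝ)
    + (∫ t in (0 : ℝ)..ξ, potential τ φ t * (leadCoeff φ t)⁻¹ : ℝ))

/-- The solution `w ^ (-1/2) exp (-2πi ∫₀ (z + r) / w)` of `fourierSideOp τ φ ψ = z ψ`. -/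
noncomputable def eigenFun (τ φ : ℝ) (z : ℂ) (ξ : ℝ) : ℂ :=
  ((Real.sqrt (leadCoeff φ ξ))⁻¹ : ℝ) * Complex.exp (eigenPhase τ φ z ξ)

theorem contDiff_inv_leadCoeff {φ : ℝ} (hφ : |Real.cos φ| < 1) :
    ContDiff ℝ ∞ fun ξ => (leadCoeff φ ξ)⁻¹ :=
  (contDiff_leadCoeff φ).inv fun ξ => (leadCoeff_pos hφ ξ).ne'

theorem contDiff_eigenFun (τ : ℝ) {φ : ℝ} (hφ : |Real.cos φ| < 1) (z : ℂ) :
    ContDiff ℝ ∞ (eigenFun τ φ z) := by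
  have h1 := contDiff_inv_leadCoeff hφ
  have h2 := Complex.ofRealCLM.contDiff.comp (contDiff_integral_zero h1)
  have h3 := Complex.ofRealCLM.contDiff.comp (contDiff_integral_zero
    ((contDiff_potential τ φ).mul h1))
  have h4 := Complex.ofRealCLM.contDiff.comp (((contDiff_leadCoeff φ).sqrt
    fun ξ => (leadCoeff_pos hφ ξ).ne').inv fun ξ => (Real.sqrt_pos.2 (leadCoeff_pos hφ ξ)).ne')
  exact h4.mul (contDiff_const.mul ((contDiff_const.mul h2).add h3)).cexp

theorem hasDerivAt_eigenFun (τ : ℝ) {φ : ℝ} (hφ : |Real.cos φ| < 1) (z : ℂ) (ξ : ℝ) :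
    HasDerivAt (eigenFun τ φ z)
      ((-(2 * Real.pi * Complex.I) * (z + potential τ φ ξ) - 2 * Real.pi *
        Real.sinh (2 * Real.pi * ξ)) / leadCoeff φ ξ * eigenFun τ φ z ξ) ξ := by
  have h1 := (contDiff_inv_leadCoeff hφ).continuous
  have hw := leadCoeff_pos hφ ξ
  have h2 := (hasDerivAt_integral_zero h1 ξ).ofReal_comp
  have h3 := (hasDerivAt_integral_zero ((continuous_potential τ φ).mul h1) ξ).ofReal_comp
  have h4 := (((hasDerivAt_leadCoeff φ ξ).sqrt hw.ne').inv (Real.sqrt_pos.2 hw).ne').ofReal_comp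
  have h5 := ((h2.const_mul z).add h3).const_mul (-(2 * Real.pi * Complex.I))
  refine (h4.mul h5.cexp).congr_deriv ?_
  have hs : (Real.sqrt (leadCoeff φ ξ) : ℂ) ≠ 0 := by exact_mod_cast (Real.sqrt_pos.2 hw).ne'
  have hs2 : (leadCoeff φ ξ : ℂ) = (Real.sqrt (leadCoeff φ ξ) : ℂ) ^ 2 := by
    rw [← Complex.ofReal_pow, Real.sq_sqrt hw.le]
  have hE : Complex.exp (-(2 * Real.pi * Complex.I) *
      (z * (∫ t in (0 : ℝ)..ξ, (leadCoeff φ t)⁻¹ : ℝ)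
        + (∫ t in (0 : ℝ)..ξ, potential τ φ t * (leadCoeff φ t)⁻¹ : ℝ)))
      = Complex.exp (eigenPhase τ φ z ξ) := rfl
  simp only [eigenFun, Pi.add_apply, Pi.mul_apply, Pi.inv_apply]
  rw [hE]
  push_cast [-Complex.ofReal_sinh]
  rw [hs2]
  field_simp
  ring

/-- Variation of constants: as `m_z` solves the equation, the product rule leaves only the term
where the derivative falls on `ψ`. -/
theorem fourierSideOp_eigenFun_mul (τ : ℝ) {φ : ℝ} (hφ : |Real.cos φ| < 1) (z : ℂ) {ψ : ℝ → ℂ}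
    (hψ : Differentiable ℝ ψ) (ξ : ℝ) :
    fourierSideOp τ φ (fun ξ => eigenFun τ φ z ξ * ψ ξ) ξ = z * (eigenFun τ φ z ξ * ψ ξ)
      + Complex.I / (2 * Real.pi) * (leadCoeff φ ξ * (eigenFun τ φ z ξ * deriv ψ ξ)) := by
  rw [fourierSideOp, ((hasDerivAt_eigenFun τ hφ z ξ).fun_mul (hψ ξ).hasDerivAt).deriv]
  have hw : (leadCoeff φ ξ : ℂ) ≠ 0 := by exact_mod_cast (leadCoeff_pos hφ ξ).ne'
  have hpi : (Real.pi : ℂ) ≠ 0 := by exact_mod_cast Real.pi_ne_zero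
  field_simp
  ring_nf
  simp only [Complex.I_sq]
  ring

/-- The exponents for `conj z` and, after conjugation, for `z` are opposite because `w` and `r` are
real. This identity inverts `m_{z̄}` and also shows that `m_z` has no zeros. -/
theorem leadCoeff_mul_eigenFun_mul_conj (τ : ℝ) {φ : ℝ} (hφ : |Real.cos φ| < 1) (z : ℂ) (ξ : ℝ) :
    leadCoeff φ ξ * eigenFun τ φ (conj z) ξ * conj (eigenFun τ φ z ξ) = 1 := by
  have hw := leadCoeff_pos hφ ξ
  have hs : (Real.sqrt (leadCoeff φ ξ) : ℂ) ≠ 0 := by exact_mod_cast (Real.sqrt_pos.2 hw).ne'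
  have hs2 : (leadCoeff φ ξ : ℂ) = (Real.sqrt (leadCoeff φ ξ) : ℂ) ^ 2 := by
    rw [← Complex.ofReal_pow, Real.sq_sqrt hw.le]
  have hE : Complex.exp (eigenPhase τ φ (conj z) ξ) * conj (Complex.exp (eigenPhase τ φ z ξ))
      = 1 := by
    rw [← Complex.exp_conj, ← Complex.exp_add, eigenPhase, eigenPhase]
    simp only [map_mul, map_neg, map_add, Complex.conj_ofReal, Complex.conj_I, Complex.conj_ofNat]
    rw [← Complex.exp_zero]
    congr 1
    ring
  simp only [eigenFun, map_mul, Complex.conj_ofReal]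
  rw [hs2]
  push_cast
  calc _ = ((Real.sqrt (leadCoeff φ ξ) : ℂ) * (Real.sqrt (leadCoeff φ ξ) : ℂ)⁻¹) ^ 2 *
        (Complex.exp (eigenPhase τ φ (conj z) ξ) * conj (Complex.exp (eigenPhase τ φ z ξ))) := by
        ring
    _ = 1 := by rw [hE, mul_inv_cancel₀ hs]; norm_num

/-- The real part of the exponent is `2π Im z ∫₀ 1/w`, bounded because `1/w` is integrable over the
line; the remaining factor `w^(-1/2)` is in `L²` for the same reason. The sign of `Im z` plays no
role, so both defect indices are equal. -/
theorem memLp_eigenFun (τ : ℝ) {φ : ℝ} (hφ : |Real.cos φ| < 1) (z : ℂ) :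
    MemLp (eigenFun τ φ z) 2 volume := by
  have hc := (contDiff_eigenFun τ hφ z).continuous
  rw [memLp_two_iff_integrable_sq_norm hc.aestronglyMeasurable]
  have hi := integrable_inv_leadCoeff hφ
  set B := ∫ ξ, (leadCoeff φ ξ)⁻¹
  refine (hi.mul_const (Real.exp (2 * Real.pi * |z.im| * B) ^ 2)).mono'
    (hc.norm.pow 2).aestronglyMeasurable (Eventually.of_forall fun ξ => ?_)
  have hw := leadCoeff_pos hφ ξ
  have hP : |∫ t in (0 : ℝ)..ξ, (leadCoeff φ t)⁻¹| ≤ B := by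
    refine (intervalIntegral.norm_integral_le_integral_norm_uIoc
      (f := fun t => (leadCoeff φ t)⁻¹) (μ := volume)).trans ?_
    have : ∀ t, ‖(leadCoeff φ t)⁻¹‖ = (leadCoeff φ t)⁻¹ := fun t =>
      abs_of_pos (inv_pos.2 (leadCoeff_pos hφ t))
    simp only [this]
    exact setIntegral_le_integral hi (Eventually.of_forall fun t =>
      (inv_pos.2 (leadCoeff_pos hφ t)).le)
  have hE : ‖Complex.exp (eigenPhase τ φ z ξ)‖ ≤ Real.exp (2 * Real.pi * |z.im| * B) := by
    rw [Complex.norm_exp]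
    refine Real.exp_le_exp.2 ?_
    have : (eigenPhase τ φ z ξ).re
        = 2 * Real.pi * (z.im * ∫ t in (0 : ℝ)..ξ, (leadCoeff φ t)⁻¹) := by
      simp [eigenPhase, -Complex.ofReal_inv]
    rw [this, mul_assoc _ |z.im|]
    refine mul_le_mul_of_nonneg_left ((le_abs_self _).trans ?_) Real.two_pi_pos.le
    rw [abs_mul]
    gcongr
  rw [Real.norm_eq_abs, abs_of_nonneg (by positivity), eigenFun, norm_mul, mul_pow]
  gcongr
  rw [Complex.norm_real, Real.norm_eq_abs, sq_abs, inv_pow, Real.sq_sqrt hw.le]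

/-! ### The lemma of du Bois-Reymond. -/

/-- A smooth compactly supported function with zero integral is the derivative of a smooth
compactly supported function. -/
theorem exists_contDiff_hasCompactSupport_deriv_eq {θ : ℝ → ℝ} (hθ : ContDiff ℝ ∞ θ)
    (hc : HasCompactSupport θ) (h0 : ∫ x, θ x = 0) :
    ∃ ψ : ℝ → ℝ, ContDiff ℝ ∞ ψ ∧ HasCompactSupport ψ ∧ deriv ψ = θ := by
  obtain ⟨R, hR⟩ := hc.isCompact.isBounded.subset_closedBall (0 : ℝ)
  have hz : ∀ x, R < |x| → θ x = 0 := fun x hx => by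
    refine image_eq_zero_of_notMem_tsupport fun h => ?_
    have := hR h
    rw [mem_closedBall_zero_iff, Real.norm_eq_abs] at this
    linarith
  have hi : Integrable θ := hθ.continuous.integrable_of_hasCompactSupport hc
  have hsplit : ∀ x, ∫ t in Set.Iic x, θ t
      = (∫ t in (0 : ℝ)..x, θ t) + ∫ t in Set.Iic 0, θ t := fun x => by
    rw [← intervalIntegral.integral_Iic_sub_Iic hi.integrableOn hi.integrableOn, sub_add_cancel]
  have hψ : (fun x => ∫ t in Set.Iic x, θ t)
      = fun x => (∫ t in (0 : ℝ)..x, θ t) + ∫ t in Set.Iic 0, θ t := funext hsplit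
  refine ⟨fun x => ∫ t in Set.Iic x, θ t, ?_, ?_, ?_⟩
  · rw [hψ]
    exact (contDiff_integral_zero hθ).add contDiff_const
  · refine HasCompactSupport.intro (isCompact_closedBall (0 : ℝ) R) fun x hx => ?_
    rw [mem_closedBall_zero_iff, Real.norm_eq_abs, not_le] at hx
    rcases lt_or_ge x 0 with hx0 | hx0
    · refine setIntegral_eq_zero_of_forall_eq_zero fun t ht => hz t ?_
      have ht : t ≤ x := ht
      rw [abs_of_neg hx0] at hx
      rw [abs_of_neg (by linarith)]
      linarith
    · rw [setIntegral_eq_integral_of_forall_compl_eq_zero, h0]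
      intro t ht
      have ht : x < t := not_le.1 ht
      refine hz t ?_
      rw [abs_of_nonneg hx0] at hx
      exact hx.trans (ht.trans_le (le_abs_self t))
  · rw [hψ]
    ext x
    exact ((hasDerivAt_integral_zero hθ.continuous x).add_const _).deriv

/-- The lemma of du Bois-Reymond: a locally integrable function with zero weak derivative is
almost everywhere constant. -/
theorem ae_eq_const_of_integral_deriv_mul_eq_zero {f : ℝ → ℂ} (hf : LocallyIntegrable f)
    (h : ∀ ψ : ℝ → ℝ, ContDiff ℝ ∞ ψ → HasCompactSupport ψ → ∫ x, deriv ψ x • f x = 0) :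
    ∃ c : ℂ, ∀ᵐ x, f x = c := by
  let b : ContDiffBump (0 : ℝ) := ⟨1, 2, one_pos, one_lt_two⟩
  set ρ := b.normed volume
  have hρ : ContDiff ℝ ∞ ρ := b.contDiff_normed
  have hρc : HasCompactSupport ρ := b.hasCompactSupport_normed
  have hρ1 : ∫ x, ρ x = 1 := b.integral_normed
  refine ⟨∫ x, ρ x • f x, ?_⟩
  set c := ∫ x, ρ x • f x
  have hfi : ∀ η : ℝ → ℝ, ContDiff ℝ ∞ η → HasCompactSupport η →
      Integrable fun x => η x • f x := fun η hη hηc =>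
    hf.integrable_smul_left_of_hasCompactSupport hη.continuous hηc
  have key := ae_eq_zero_of_integral_contDiff_smul_eq_zero (f := fun x => f x - c)
    (hf.sub (locallyIntegrable_const c)) fun η hη hηc => ?_
  · filter_upwards [key] with x hx using sub_eq_zero.1 hx
  · have hηi := hη.continuous.integrable_of_hasCompactSupport (μ := volume) hηc
    have hρi := hρ.continuous.integrable_of_hasCompactSupport (μ := volume) hρc
    -- Subtracting `(∫ η) ρ` gives `η` zero mean, hence a test function as primitive.
    obtain ⟨ψ, hψ, hψc, hd⟩ := exists_contDiff_hasCompactSupport_deriv_eq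
      (θ := fun x => η x - (∫ y, η y) * ρ x) (hη.sub (contDiff_const.mul hρ))
      (hηc.sub (hρc.mul_left (f := fun _ => ∫ y, η y))) (by
        rw [integral_sub hηi (hρi.const_mul _), integral_const_mul, hρ1, mul_one, sub_self])
    have h1 := h ψ hψ hψc
    rw [hd] at h1
    simp only [sub_smul, mul_smul] at h1
    rw [integral_sub (hfi η hη hηc) ((hfi ρ hρ hρc).fun_smul _), integral_smul] at h1
    simp only [smul_sub]
    rw [integral_sub (hfi η hη hηc) (hηi.smul_const c), integral_smul_const]
    exact h1

/-! ### Test elements and density of the domain. -/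

/-- The element of `stripSpace` whose Fourier transform is a given test function. -/
noncomputable def testElement {ψ : ℝ → ℂ} (hψ : ContDiff ℝ ∞ ψ) (hc : HasCompactSupport ψ) :
    stripSpace :=
  ⟨fourierLaplace ψ, fourierLaplace_mem hψ hc⟩

theorem L2R_inner_toLp_left {f : ℝ → ℂ} (hf : MemLp f 2 volume) (g : L2R) :
    ⟪(hf.toLp f : L2R), g⟫_ℂ = ∫ x, g x * conj (f x) := by
  conv_lhs => rw [← Lp.toLp_coeFn g (Lp.memLp g)]
  exact L2R_inner_toLp hf (Lp.memLp g)

theorem L2R_inner_toLp_right {f : ℝ → ℂ} (hf : MemLp f 2 volume) (g : L2R) :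
    ⟪g, (hf.toLp f : L2R)⟫_ℂ = ∫ x, f x * conj (g x) := by
  conv_lhs => rw [← Lp.toLp_coeFn g (Lp.memLp g)]
  exact L2R_inner_toLp (Lp.memLp g) hf

section TestElement

variable {ψ : ℝ → ℂ} (hψ : ContDiff ℝ ∞ ψ) (hc : HasCompactSupport ψ)

theorem fourier_stripRestrict_testElement :
    𝓕 (stripRestrict (testElement hψ hc))
      = ((memLp_of_hasCompactSupport hψ.continuous hc).toLp ψ : L2R) :=
  fourier_toLp_fourierLaplace hψ hc (stripSpace_memLp (fourierLaplace_mem hψ hc))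

theorem inner_stripRestrict_testElement (u : L2R) :
    ⟪u, stripRestrict (testElement hψ hc)⟫_ℂ = ∫ ξ, ψ ξ * conj ((𝓕 u : L2R) ξ) := by
  rw [← Lp.inner_fourier_eq, fourier_stripRestrict_testElement, L2R_inner_toLp_right]

theorem stripRestrict_testElement_inner (u : L2R) :
    ⟪stripRestrict (testElement hψ hc), u⟫_ℂ = ∫ ξ, (𝓕 u : L2R) ξ * conj (ψ ξ) := by
  rw [← Lp.inner_fourier_eq, fourier_stripRestrict_testElement, L2R_inner_toLp_left]

theorem stripDiff_testElement (τ φ : ℝ) :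
    stripDiff τ φ (testElement hψ hc) = stripRestrict (testElement
      (contDiff_fourierSideOp τ φ hψ) (hasCompactSupport_fourierSideOp τ φ hc)) :=
  MemLp.toLp_congr (diffExpr_memLp τ φ (fourierLaplace_mem hψ hc)) (stripSpace_memLp
    (fourierLaplace_mem (contDiff_fourierSideOp τ φ hψ) (hasCompactSupport_fourierSideOp τ φ hc)))
    (Eventually.of_forall fun x => diffExpr_fourierLaplace τ φ hψ hc x)

end TestElement

theorem leadExpr_memLp (φ : ℝ) {f : ℂ → ℂ} (hf : f ∈ stripSpace) :
    MemLp (fun x : ℝ => leadExpr φ f x) 2 volume :=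
  shiftExpr_memLp hf _ _ _ _ _ _

/-- Weak form of the statement that `w` times the transform of `f` is the transform of `leadExpr φ
f`, hence square integrable, although `w` grows exponentially. It comes from the symmetry of
`leadExpr`. -/
theorem integral_fourier_mul_conj_leadCoeff_mul (φ : ℝ) {ψ : ℝ → ℂ} (hψ : ContDiff ℝ ∞ ψ)
    (hc : HasCompactSupport ψ) (f : stripSpace) :
    ∫ ξ, (𝓕 (stripRestrict f) : L2R) ξ * conj (leadCoeff φ ξ * ψ ξ)
      = ∫ ξ, (𝓕 ((leadExpr_memLp φ f.2).toLp _) : L2R) ξ * conj (ψ ξ) := by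
  have hw : ContDiff ℝ ∞ fun ξ => (leadCoeff φ ξ : ℂ) * ψ ξ :=
    (Complex.ofRealCLM.contDiff.comp (contDiff_leadCoeff φ)).mul hψ
  have hwc : HasCompactSupport fun ξ => (leadCoeff φ ξ : ℂ) * ψ ξ := hc.mul_left
  rw [← stripRestrict_testElement_inner hψ hc, ← stripRestrict_testElement_inner hw hwc]
  have h1 := L2R_inner_toLp (stripSpace_memLp (fourierLaplace_mem hw hwc)) (stripSpace_memLp f.2)
  have h2 := L2R_inner_toLp (stripSpace_memLp (fourierLaplace_mem hψ hc)) (leadExpr_memLp φ f.2)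
  rw [leadExpr_integral φ f.2 (fourierLaplace_mem hψ hc)] at h2
  simp only [leadExpr_fourierLaplace φ hψ hc] at h2
  exact h1.trans h2.symm

theorem L2R_locallyIntegrable (u : L2R) : LocallyIntegrable (u : ℝ → ℂ) :=
  (Lp.memLp u).locallyIntegrable one_le_two

theorem LocallyIntegrable.conj_comp {f : ℝ → ℂ} (hf : LocallyIntegrable f) :
    LocallyIntegrable fun x => conj (f x) := fun x => by
  obtain ⟨s, hs, hi⟩ := hf x
  exact ⟨s, hs, (Complex.conjCLE : ℂ ≃L[ℝ] ℂ).toContinuousLinearMap.integrable_comp hi⟩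

/-- The transforms of the domain include all test functions, so by Plancherel a vector orthogonal to
the domain vanishes. -/
theorem dense_range_stripRestrict : Dense (LinearMap.range stripRestrict : Set L2R) := by
  rw [Submodule.dense_iff_topologicalClosure_eq_top, Submodule.topologicalClosure_eq_top_iff,
    Submodule.eq_bot_iff]
  intro u hu
  have h0 : (𝓕 u : L2R) = 0 := by
    rw [Lp.eq_zero_iff_ae_eq_zero]
    have key := ae_eq_zero_of_integral_contDiff_smul_eq_zero
      (LocallyIntegrable.conj_comp (L2R_locallyIntegrable (𝓕 u))) fun η hη hηc => ?_
    · filter_upwards [key] with x hx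
      simpa using hx
    · have hη' : ContDiff ℝ ∞ fun ξ => (η ξ : ℂ) := Complex.ofRealCLM.contDiff.comp hη
      have hηc' : HasCompactSupport fun ξ => (η ξ : ℂ) := hηc.comp_left Complex.ofReal_zero
      have := (Submodule.mem_orthogonal' _ _).1 hu _
        (LinearMap.mem_range_self stripRestrict (testElement hη' hηc'))
      rw [inner_stripRestrict_testElement] at this
      simpa using this
  rw [← norm_eq_zero, ← Lp.norm_fourier_eq, h0, norm_zero]

/-! ### Eigenvectors of the adjoint. -/

/-- The element of `L²(ℝ)` whose Fourier transform is `eigenFun τ φ z`. -/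
noncomputable def eigenVector (τ : ℝ) {φ : ℝ} (hφ : |Real.cos φ| < 1) (z : ℂ) : L2R :=
  𝓕⁻ ((memLp_eigenFun τ hφ z).toLp _ : L2R)

theorem fourier_eigenVector (τ : ℝ) {φ : ℝ} (hφ : |Real.cos φ| < 1) (z : ℂ) :
    𝓕 (eigenVector τ hφ z) = ((memLp_eigenFun τ hφ z).toLp _ : L2R) :=
  FourierTransform.fourier_fourierInv_eq _

theorem eigenVector_ne_zero (τ : ℝ) {φ : ℝ} (hφ : |Real.cos φ| < 1) (z : ℂ) :
    eigenVector τ hφ z ≠ 0 := by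
  intro h
  have h1 : ((memLp_eigenFun τ hφ z).toLp _ : L2R) = 0 := by
    rw [← norm_eq_zero, ← fourier_eigenVector τ hφ z, Lp.norm_fourier_eq, h, norm_zero]
  have h2 : eigenFun τ φ z =ᵐ[volume] fun _ => 0 := by
    refine (memLp_eigenFun τ hφ z).coeFn_toLp.symm.trans ?_
    rw [h1]
    exact Lp.coeFn_zero _ _ _
  have h3 := congrFun (Measure.eq_of_ae_eq h2 (contDiff_eigenFun τ hφ z).continuous
    continuous_const) 0
  have h4 := leadCoeff_mul_eigenFun_mul_conj τ hφ z 0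
  rw [h3] at h4
  simp at h4

/-- The hypothesis says that `u` is an eigenvector of the adjoint for `z`. Only test elements are
needed to determine it: they express the differential equation for its transform in the weak sense.
-/
theorem exists_eq_smul_eigenVector (τ : ℝ) {φ : ℝ} (hφ : |Real.cos φ| < 1) (z : ℂ) {u : L2R}
    (hu : ∀ f : stripSpace, ⟪z • u, stripRestrict f⟫_ℂ = ⟪u, stripDiff τ φ f⟫_ℂ) :
    ∃ c : ℂ, c • eigenVector τ hφ z = u := by
  set U : L2R := 𝓕 u
  have hm := contDiff_eigenFun τ hφ (conj z)
  have hloc : LocallyIntegrable fun ξ =>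
      (leadCoeff φ ξ * eigenFun τ φ (conj z) ξ) * conj (U ξ) := by
    refine (LocallyIntegrable.conj_comp (L2R_locallyIntegrable U)).continuous_mul ?_
    have := continuous_leadCoeff φ
    have := hm.continuous
    fun_prop
  obtain ⟨c, hc⟩ := ae_eq_const_of_integral_deriv_mul_eq_zero hloc fun η hη hηc => by
    have hη' : ContDiff ℝ ∞ fun ξ => (η ξ : ℂ) := Complex.ofRealCLM.contDiff.comp hη
    have hηc' : HasCompactSupport fun ξ => (η ξ : ℂ) := hηc.comp_left Complex.ofReal_zero
    -- With this test function the terms in `conj z` cancel and only `η'` remains; `conj z` appears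
    -- because the inner product is conjugate linear in `u`.
    have hψ : ContDiff ℝ ∞ fun ξ => eigenFun τ φ (conj z) ξ * η ξ := hm.mul hη'
    have hψc : HasCompactSupport fun ξ => eigenFun τ φ (conj z) ξ * η ξ := hηc'.mul_left
    have h := hu (testElement hψ hψc)
    rw [stripDiff_testElement, inner_smul_left, inner_stripRestrict_testElement,
      inner_stripRestrict_testElement] at h
    have hd : ∀ ξ, deriv (fun ξ => (η ξ : ℂ)) ξ = (deriv η ξ : ℝ) := fun ξ =>
      ((hη.differentiable (by simp) ξ).hasDerivAt.ofReal_comp).deriv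
    have i1 : Integrable fun ξ => eigenFun τ φ (conj z) ξ * η ξ * conj (U ξ) :=
      integrable_mul_conj (Lp.memLp U) (memLp_of_hasCompactSupport hψ.continuous hψc)
    have i2 : Integrable fun ξ => deriv η ξ •
        ((leadCoeff φ ξ * eigenFun τ φ (conj z) ξ) * conj (U ξ)) :=
      hloc.integrable_smul_left_of_hasCompactSupport
        (contDiff_infty_iff_deriv.1 hη).2.continuous hηc.deriv
    have e : ∀ ξ, fourierSideOp τ φ (fun ξ => eigenFun τ φ (conj z) ξ * η ξ) ξ * conj (U ξ)
        = conj z * (eigenFun τ φ (conj z) ξ * η ξ * conj (U ξ)) + Complex.I / (2 * Real.pi) *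
          (deriv η ξ • ((leadCoeff φ ξ * eigenFun τ φ (conj z) ξ) * conj (U ξ))) := fun ξ => by
      rw [fourierSideOp_eigenFun_mul τ hφ _ (hη'.differentiable (by simp)), hd, Complex.real_smul]
      ring
    rw [integral_congr_ae (Eventually.of_forall e), integral_add (i1.const_mul _) (i2.const_mul _), integral_const_mul, integral_const_mul,
      left_eq_add] at h
    refine (mul_eq_zero.1 h).resolve_left ?_
    simp [Real.pi_ne_zero]
  refine ⟨conj c, ?_⟩
  have hU : (conj c) • ((memLp_eigenFun τ hφ z).toLp _ : L2R) = U := by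
    refine Lp.ext ?_
    filter_upwards [hc, Lp.coeFn_smul (conj c) ((memLp_eigenFun τ hφ z).toLp _ : L2R),
      (memLp_eigenFun τ hφ z).coeFn_toLp] with ξ h1 h2 h3
    rw [h2, Pi.smul_apply, h3, smul_eq_mul, ← h1]
    have h4 := leadCoeff_mul_eigenFun_mul_conj τ hφ z ξ
    have h5 := congrArg conj h4
    simp only [map_mul, Complex.conj_conj, Complex.conj_ofReal, map_one] at h5 ⊢
    linear_combination U ξ * h5
  have := congrArg (fun v : L2R => (𝓕⁻ v : L2R)) hU
  simp only [U, FourierTransform.fourierInv_fourier_eq, FourierTransform.fourierInv_smul] at this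
  exact this

theorem tendsto_integral_mul_conj_mul (h : L2R) {m : ℝ → ℂ} (hm : Continuous m)
    (hm2 : MemLp m 2 volume) {a : ℕ → ℝ → ℂ} (ha : ∀ n, Continuous (a n)) {M : ℝ}
    (hM : ∀ n ξ, ‖a n ξ‖ ≤ M) {b : ℂ} (hb : ∀ ξ, Tendsto (fun n => a n ξ) atTop (𝓝 b)) :
    Tendsto (fun n => ∫ ξ, h ξ * conj (m ξ * a n ξ)) atTop (𝓝 (∫ ξ, h ξ * conj (m ξ * b))) := by
  have hi := integrable_mul_conj hm2 (Lp.memLp h)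
  refine tendsto_integral_of_dominated_convergence (fun ξ => ‖h ξ * conj (m ξ)‖ * M) (fun n => ?_)
    (hi.norm.mul_const M) (fun n => Eventually.of_forall fun ξ => ?_)
    (Eventually.of_forall fun ξ => ?_)
  · exact (Lp.aestronglyMeasurable h).mul
      (Complex.continuous_conj.comp (hm.mul (ha n))).aestronglyMeasurable
  · rw [map_mul, ← mul_assoc, norm_mul, RCLike.norm_conj (a n ξ)]
    gcongr
    exact hM n ξ
  · exact ((Complex.continuous_conj.tendsto _).comp ((hb ξ).const_mul _)).const_mul _

/-- Symmetry applies to the test elements with transform `m_z χ_n`, where `χ_n` is a cutoff at scale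
`n + 1`. The error contains `w m_z χ_n'`; moving `w` onto `f` turns it into the pairing of a fixed
`L²` function with `m_z χ_n'`, which tends to zero since `χ_n' = O(1/n)`. -/
theorem inner_eigenVector_stripDiff (τ : ℝ) {φ : ℝ} (hφ : |Real.cos φ| < 1) (z : ℂ)
    (f : stripSpace) :
    ⟪z • eigenVector τ hφ z, stripRestrict f⟫_ℂ = ⟪eigenVector τ hφ z, stripDiff τ φ f⟫_ℂ := by
  let b : ContDiffBump (0 : ℝ) := ⟨1, 2, one_pos, one_lt_two⟩
  have hb : ContDiff ℝ ∞ b := b.contDiff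
  set χ : ℕ → ℝ → ℝ := fun n ξ => b ((n + 1 : ℝ)⁻¹ * ξ)
  have hn : ∀ n : ℕ, (n + 1 : ℝ)⁻¹ ≠ 0 := fun n => by positivity
  have hχ : ∀ n, ContDiff ℝ ∞ (χ n) := fun n => hb.comp (contDiff_const.mul contDiff_id)
  have hχc : ∀ n, HasCompactSupport (χ n) := fun n =>
    b.hasCompactSupport.comp_homeomorph (Homeomorph.mulLeft₀ _ (hn n))
  have hχd : ∀ n ξ, deriv (χ n) ξ = (n + 1 : ℝ)⁻¹ * deriv b ((n + 1 : ℝ)⁻¹ * ξ) := fun n ξ => by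
    have := (hb.differentiable (by simp) ((n + 1 : ℝ)⁻¹ * ξ)).hasDerivAt.comp ξ
      ((hasDerivAt_id ξ).const_mul (n + 1 : ℝ)⁻¹)
    rw [mul_one] at this
    rw [mul_comm]
    exact this.deriv
  have hbd : Continuous (deriv b) := (contDiff_infty_iff_deriv.1 hb).2.continuous
  obtain ⟨M, hM⟩ := hbd.bounded_above_of_compact_support b.hasCompactSupport.deriv
  have hn0 : Tendsto (fun n : ℕ => ((n : ℝ) + 1)⁻¹) atTop (𝓝 0) :=
    tendsto_inv_atTop_zero.comp (tendsto_natCast_atTop_atTop.atTop_add tendsto_const_nhds)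
  have hM0 : 0 ≤ M := (norm_nonneg _).trans (hM 0)
  have hdle : ∀ n ξ, ‖((deriv (χ n) ξ : ℝ) : ℂ)‖ ≤ ((n : ℝ) + 1)⁻¹ * M := fun n ξ => by
    rw [Complex.norm_real, hχd, norm_mul, Real.norm_of_nonneg (by positivity)]
    gcongr
    exact hM _
  have hm := contDiff_eigenFun τ hφ z
  have hm2 := memLp_eigenFun τ hφ z
  have hχ' : ∀ n, ContDiff ℝ ∞ fun ξ => (χ n ξ : ℂ) := fun n =>
    Complex.ofRealCLM.contDiff.comp (hχ n)
  have hχc' : ∀ n, HasCompactSupport fun ξ => (χ n ξ : ℂ) := fun n =>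
    (hχc n).comp_left Complex.ofReal_zero
  have hχ1 : ∀ n, ContDiff ℝ ∞ fun ξ => ((deriv (χ n) ξ : ℝ) : ℂ) := fun n =>
    Complex.ofRealCLM.contDiff.comp (contDiff_infty_iff_deriv.1 (hχ n)).2
  have hχc1 : ∀ n, HasCompactSupport fun ξ => ((deriv (χ n) ξ : ℝ) : ℂ) := fun n =>
    (hχc n).deriv.comp_left Complex.ofReal_zero
  have lim : ∀ h : L2R, Tendsto (fun n => ∫ ξ, h ξ * conj (eigenFun τ φ z ξ * χ n ξ)) atTop
      (𝓝 (∫ ξ, h ξ * conj (eigenFun τ φ z ξ * 1))) := fun h => by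
    refine tendsto_integral_mul_conj_mul h hm.continuous hm2 (a := fun n ξ => (χ n ξ : ℂ)) (M := 1)
      (fun n => (hχ' n).continuous) (fun n ξ => ?_) fun ξ => ?_
    · rw [Complex.norm_real, Real.norm_of_nonneg b.nonneg]
      exact b.le_one
    · have h1 : Tendsto (fun n : ℕ => ((n : ℝ) + 1)⁻¹ * ξ) atTop (𝓝 0) := by
        simpa using hn0.mul_const ξ
      have h2 := (hb.continuous.tendsto 0).comp h1
      rw [b.one_of_mem_closedBall (by simp [b])] at h2
      rw [← Complex.ofReal_one]
      exact (Complex.continuous_ofReal.tendsto _).comp h2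
  have lim' : ∀ h : L2R, Tendsto
      (fun n => ∫ ξ, h ξ * conj (eigenFun τ φ z ξ * (deriv (χ n) ξ : ℝ))) atTop
      (𝓝 (∫ ξ, h ξ * conj (eigenFun τ φ z ξ * 0))) := fun h => by
    refine tendsto_integral_mul_conj_mul h hm.continuous hm2
      (a := fun n ξ => ((deriv (χ n) ξ : ℝ) : ℂ)) (M := M)
      (fun n => (hχ1 n).continuous) (fun n ξ => (hdle n ξ).trans ?_) fun ξ => ?_
    · refine mul_le_of_le_one_left hM0 (inv_le_one_of_one_le₀ ?_)
      linarith [(Nat.cast_nonneg n : (0 : ℝ) ≤ n)]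
    · exact squeeze_zero_norm (fun n => hdle n ξ) (by simpa using hn0.mul_const M)
  have key : ∀ n, ∫ ξ, (𝓕 (stripDiff τ φ f) : L2R) ξ * conj (eigenFun τ φ z ξ * χ n ξ)
      = conj z * (∫ ξ, (𝓕 (stripRestrict f) : L2R) ξ * conj (eigenFun τ φ z ξ * χ n ξ))
        + conj (Complex.I / (2 * Real.pi)) *
        ∫ ξ, (𝓕 ((leadExpr_memLp φ f.2).toLp _) : L2R) ξ *
          conj (eigenFun τ φ z ξ * (deriv (χ n) ξ : ℝ)) := by
    intro n
    have hψ : ContDiff ℝ ∞ fun ξ => eigenFun τ φ z ξ * χ n ξ := hm.mul (hχ' n)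
    have hψc : HasCompactSupport fun ξ => eigenFun τ φ z ξ * χ n ξ := (hχc' n).mul_left
    have hη : ContDiff ℝ ∞ fun ξ => eigenFun τ φ z ξ * (deriv (χ n) ξ : ℝ) := hm.mul (hχ1 n)
    have hηc : HasCompactSupport fun ξ => eigenFun τ φ z ξ * (deriv (χ n) ξ : ℝ) :=
      (hχc1 n).mul_left
    have hw : Continuous fun ξ => leadCoeff φ ξ * (eigenFun τ φ z ξ * (deriv (χ n) ξ : ℝ)) :=
      (Complex.continuous_ofReal.comp (continuous_leadCoeff φ)).mul hη.continuous
    have hwc : HasCompactSupport fun ξ =>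
      (leadCoeff φ ξ : ℂ) * (eigenFun τ φ z ξ * (deriv (χ n) ξ : ℝ)) := hηc.mul_left
    have hd : ∀ ξ, deriv (fun ξ => (χ n ξ : ℂ)) ξ = (deriv (χ n) ξ : ℝ) := fun ξ =>
      (((hχ n).differentiable (by simp) ξ).hasDerivAt.ofReal_comp).deriv
    have h := inner_stripDiff τ φ (testElement hψ hψc) f
    rw [stripDiff_testElement, stripRestrict_testElement_inner, stripRestrict_testElement_inner] at h
    have i1 := integrable_mul_conj (memLp_of_hasCompactSupport hψ.continuous hψc)
      (Lp.memLp (𝓕 (stripRestrict f) : L2R))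
    have i2 := integrable_mul_conj (memLp_of_hasCompactSupport hw hwc)
      (Lp.memLp (𝓕 (stripRestrict f) : L2R))
    rw [← integral_fourier_mul_conj_leadCoeff_mul φ hη hηc f, ← integral_const_mul,
      ← integral_const_mul, ← integral_add (i1.const_mul _) (i2.const_mul _)]
    refine h.symm.trans (integral_congr_ae (Eventually.of_forall fun ξ => ?_))
    simp only
    rw [fourierSideOp_eigenFun_mul τ hφ _ ((hχ' n).differentiable (by simp)), hd]
    simp only [map_add, map_mul]
    ring
  -- In the limit `χ_n → 1` and `χ_n' → 0`, so only the eigenvalue identity survives.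
  have hl := tendsto_nhds_unique ((lim _).congr key)
    (((lim _).const_mul _).add ((lim' _).const_mul _))
  simp only [mul_one, mul_zero, map_zero, integral_zero, add_zero] at hl
  rw [inner_smul_left, ← Lp.inner_fourier_eq (eigenVector τ hφ z) (stripRestrict f),
    ← Lp.inner_fourier_eq (eigenVector τ hφ z) (stripDiff τ φ f), fourier_eigenVector,
    L2R_inner_toLp_left, L2R_inner_toLp_left]
  exact hl.symm

theorem diffOp_isFormalAdjoint (τ φ : ℝ) : (diffOp τ φ).IsFormalAdjoint (diffOp τ φ) := by
  rintro ⟨_, f, rfl⟩ ⟨_, g, rfl⟩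
  rw [diffOp_apply, diffOp_apply]
  exact inner_stripDiff τ φ f g

theorem rank_defectSpace_diffOp (τ : ℝ) {φ : ℝ} (hφ : |Real.cos φ| < 1) (z : ℂ) :
    Module.rank ℂ (defectSpace (diffOp τ φ) z) = 1 := by
  have hd : Dense ((diffOp τ φ).domain : Set L2R) := dense_range_stripRestrict
  have hv : ∀ x : (diffOp τ φ).domain,
      ⟪z • eigenVector τ hφ z, (x : L2R)⟫_ℂ = ⟪eigenVector τ hφ z, diffOp τ φ x⟫_ℂ := by
    rintro ⟨_, f, rfl⟩
    rw [diffOp_apply]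
    exact inner_eigenVector_stripDiff τ hφ z f
  have hmem := LinearPMap.mem_adjoint_domain_of_exists _ ⟨_, hv⟩
  refine rank_eq_one (⟨⟨eigenVector τ hφ z, hmem⟩, ?_⟩ : defectSpace (diffOp τ φ) z) ?_ ?_
  · rw [defectSpace, LinearMap.mem_ker, LinearMap.sub_apply, sub_eq_zero]
    exact LinearPMap.adjoint_apply_eq hd _ hv
  · intro h
    exact eigenVector_ne_zero τ hφ z (congrArg Subtype.val (congrArg Subtype.val h))
  · rintro ⟨u, hu⟩
    rw [defectSpace, LinearMap.mem_ker, LinearMap.sub_apply, sub_eq_zero] at hu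
    have hu' : (diffOp τ φ).adjoint u = z • (u : L2R) := hu
    obtain ⟨c, hc⟩ := exists_eq_smul_eigenVector τ hφ z (u := u) fun f => by
      have := LinearPMap.adjoint_isFormalAdjoint hd u
        ⟨stripRestrict f, LinearMap.mem_range_self _ f⟩
      rwa [hu', diffOp_apply] at this
    exact ⟨c, Subtype.ext (Subtype.ext hc)⟩

/-! ### Defect spaces and self-adjointness in an abstract Hilbert space. -/

section Abstract

variable {H : Type*} [NormedAddCommGroup H] [InnerProductSpace ℂ H] [CompleteSpace H]

/-- The adjoint of the closure of a densely defined operator extends its adjoint. -/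
theorem adjoint_le_adjoint_closure {T : H →ₗ.[ℂ] H} (hT : Dense (T.domain : Set H)) :
    T.adjoint ≤ T.closure.adjoint := by
  by_cases hc : T.IsClosable
  swap
  -- The closure of an operator that is not closable is by convention the operator itself.
  · rw [LinearPMap.closure_def' hc]
  refine LinearPMap.IsFormalAdjoint.le_adjoint (hT.mono T.le_closure.1) fun x y => ?_
  have hcl : IsClosed {p : H × H | ⟪p.2, (y : H)⟫_ℂ = ⟪p.1, T.adjoint y⟫_ℂ} :=
    isClosed_eq (by fun_prop) (by fun_prop)
  -- The adjoint identity against a fixed `y` is a closed condition on the graph, so it passes to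
  -- the closure.
  have hsub : (T.graph : Set (H × H)) ⊆ {p : H × H | ⟪p.2, (y : H)⟫_ℂ = ⟪p.1, T.adjoint y⟫_ℂ} := by
    rintro p hp
    obtain ⟨w, hw₁, hw₂⟩ := (LinearPMap.mem_graph_iff T).1 hp
    rw [Set.mem_ofPred_eq, ← hw₁, ← hw₂]
    exact (LinearPMap.adjoint_isFormalAdjoint hT).symm w y
  have hx : ((x : H), T.closure x) ∈ T.graph.topologicalClosure := by
    rw [hc.graph_closure_eq_closure_graph]
    exact T.closure.mem_graph x
  exact closure_minimal hsub hcl hx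

/-- The defect space of `T` at `i` vanishes if the adjoint of `T` is contained in the adjoint of a
self-adjoint operator. -/
theorem defectSpace_I_eq_bot {T S : H →ₗ.[ℂ] H} (hS : IsSelfAdjoint S)
    (hTS : T.adjoint ≤ S.adjoint) : defectSpace T Complex.I = ⊥ := by
  rw [eq_bot_iff]
  intro u hu
  rw [defectSpace, LinearMap.mem_ker, LinearMap.sub_apply, sub_eq_zero] at hu
  have hu' : T.adjoint u = Complex.I • (u : H) := hu
  rw [LinearPMap.isSelfAdjoint_def.1 hS] at hTS
  set v : S.domain := ⟨u, hTS.1 u.2⟩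
  have hv : S v = Complex.I • (u : H) := by rw [← hu']; exact (hTS.2 rfl).symm
  have hsym := LinearPMap.adjoint_isFormalAdjoint hS.dense_domain
  rw [LinearPMap.isSelfAdjoint_def.1 hS] at hsym
  have h := hsym v v
  rw [hv] at h
  simp only [v, inner_smul_left, inner_smul_right, Complex.conj_I] at h
  -- Symmetry of `S` at its eigenvector reads `-i ‖u‖² = i ‖u‖²`.
  have h2 : (2 * Complex.I) * ⟪(u : H), (u : H)⟫_ℂ = 0 := by linear_combination -h
  have h3 := (mul_eq_zero.1 h2).resolve_left (by simp)
  rw [inner_self_eq_zero] at h3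
  exact (Submodule.mem_bot ℂ).2 (Subtype.ext h3)

end Abstract

/-! ### The theorem. -/

theorem propositionl (τ φ : ℝ) (hφ₀ : 0 < φ) (hφπ : φ < Real.pi) :
    Dense ((diffOp τ φ).domain : Set L2R) ∧
    (diffOp τ φ).IsFormalAdjoint (diffOp τ φ) ∧
    ¬ IsSelfAdjoint (diffOp τ φ) ∧
    ¬ IsSelfAdjoint (diffOp τ φ).closure ∧
    defectIndices (diffOp τ φ) = (1, 1) := by
  have hφ := abs_cos_lt_one hφ₀ hφπ
  have hd : Dense ((diffOp τ φ).domain : Set L2R) := dense_range_stripRestrict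
  have hne : defectSpace (diffOp τ φ) Complex.I ≠ ⊥ := fun h => by
    have := rank_defectSpace_diffOp τ hφ Complex.I
    rw [h, rank_bot] at this
    exact zero_ne_one this
  exact ⟨hd, diffOp_isFormalAdjoint τ φ, fun h => hne (defectSpace_I_eq_bot h le_rfl),
    fun h => hne (defectSpace_I_eq_bot h (adjoint_le_adjoint_closure hd)),
    Prod.ext (rank_defectSpace_diffOp τ hφ _) (rank_defectSpace_diffOp τ hφ _)⟩
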